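/- Let $k$ be an algebraically closed field, and let $S$ be a connected compact oriented surface with boundary $\partial S$ and $M \subset \partial S$ a non-empty finite set of marked points. Let $T$ be a (non-empty) ideal triangulation of $(S,M)$: a finite collection of arcs with end points in $M$, disjoint from each other, from $\partial S$ and from $M$ except at their end points, that cuts $S$ into finitely many triangles with vertices in $M$; each side of a triangle is either an arc of $T$ or a segment of $\partial S$ between neighbouring marked points. The Jacobian algebra of $T$ is $A = kQ/I$, where the quiver $Q$ has the arcs of $T$ as vertices and, for each angle of a triangle of $T$ between two sides $i,j$ that are arcs, one arrow $i \to j$, where $j$ follows $i$ clockwise around the marked point of the angle. The ideal $I$ is generated by the cyclic derivatives $\partial_\alpha W$, for all arrows $\alpha$, of the potential $W = \sum_\Delta \alpha_\Delta\beta_\Delta\gamma_\Delta$, the sum over the triangles $\Delta$ whose three sides are all arcs, where $\alpha_\Delta\beta_\Delta\gamma_\Delta$ is the oriented $3$-cycle in $\Delta$. View $T$ as a Brauer graph: its edges are the arcs of $T$, its vertices are the end points of the arcs, the cyclic ordering of the ends of arcs around each vertex is the clockwise one given by the orientation of $S$ (completed cyclically across the boundary), and all multiplicities are $1$. Its Brauer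 graph algebra $B_T$ is the quotient of the path algebra of the following quiver by the following relations. The vertices of the quiver are the edges of the graph, and each end of an edge $i$ at a vertex $\nu$ that is not of valency one gives an arrow from $i$ to the edge of the next end of an edge around $\nu$; let $C_{\nu,i}$ be the cycle once around $\nu$ that starts with this arrow. The relations are: $C_{\nu,i} = C_{\nu',i}$ for the two ends of an edge $i$ with end vertices $\nu,\nu'$, both of valency at least two; $C_{\nu,i}\alpha = 0$ if the other end vertex of $i$ has valency one, where $\alpha$ is the first arrow of $C_{\nu,i}$; and $\alpha\beta = 0$ for composable arrows $\alpha,\beta$ that are not consecutive in the cycle around a vertex. (If $T$ is a single edge with two end vertices of valency one, then $B_T = k[x]/(x^2)$.) Then the trivial extension $T(A) = A \ltimes \operatorname{Hom}_k(A,k)$ is isomorphic, as a $k$-algebra, to the Brauer graph algebra $B_T$. -/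

import Mathlib

noncomputable section

universe u v

/-! ### Path algebras, quotients by relations, Jacobian algebras -/

/-- The path algebra `k Q` of a quiver with vertex set `V`: the vector space with basis all
paths (including the trivial ones). Paths are written from left to right, i.e. the product `p * q`
is "first `p`, then `q`", and is zero unless `p` ends where `q` starts. -/
def PathAlgebra (k : Type u) (V : Type v) [Field k] [Quiver.{v} V] : Type (max u v) :=
  (Σ a b : V, Quiver.Path a b) →₀ k

namespace PathAlgebra

variable {k : Type u} {V : Type v} [Field k] [Quiver.{v} V]

instance : AddCommGroup (PathAlgebra k V) :=
  inferInstanceAs (AddCommGroup ((Σ a b : V, Quiver.Path a b) →₀ k))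

instance : Module k (PathAlgebra k V) :=
  inferInstanceAs (Module k ((Σ a b : V, Quiver.Path a b) →₀ k))

variable (k) in
/-- The basis element given by a path. -/
def ofPath {a b : V} (p : Quiver.Path a b) : PathAlgebra k V :=
  Finsupp.single (⟨a, b, p⟩ : Σ a b : V, Quiver.Path a b) (1 : k)

variable (k) in
/-- The basis element given by an arrow. -/
def ofArrow {a b : V} (e : a ⟶ b) : PathAlgebra k V :=
  ofPath k e.toPath

open Classical in
variable (k) in
/-- The product of two basis elements: concatenation if possible, and zero otherwise. -/
def concat (p q : Σ a b : V, Quiver.Path a b) : PathAlgebra k V :=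
  if h : p.2.1 = q.1 then ofPath k (p.2.2.comp (q.2.2.cast h.symm rfl)) else 0

/-- The linear map on the path algebra with given values on the paths. -/
def lift {N : Type*} [AddCommGroup N] [Module k N] (f : (Σ a b : V, Quiver.Path a b) → N) :
    PathAlgebra k V →ₗ[k] N :=
  Finsupp.linearCombination k f

theorem lift_ofPath {N : Type*} [AddCommGroup N] [Module k N]
    (f : (Σ a b : V, Quiver.Path a b) → N) {a b : V} (p : Quiver.Path a b) :
    lift f (ofPath k p) = f ⟨a, b, p⟩ :=
  (Finsupp.linearCombination_single k (1 : k) _).trans (one_smul k _)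

variable (k V) in
/-- The multiplication of the path algebra as a bilinear map. -/
def mulLin : PathAlgebra k V →ₗ[k] PathAlgebra k V →ₗ[k] PathAlgebra k V :=
  lift fun p => lift fun q => concat k p q

instance : Mul (PathAlgebra k V) := ⟨fun x y => mulLin k V x y⟩

theorem mul_def (x y : PathAlgebra k V) : x * y = mulLin k V x y := rfl

theorem mulLin_single (p q : Σ a b : V, Quiver.Path a b) :
    mulLin k V (ofPath k p.2.2) (ofPath k q.2.2) = concat k p q := by
  rw [mulLin, lift_ofPath, lift_ofPath]

theorem ofPath_mul_ofPath {a b c : V} (p : Quiver.Path a b) (q : Quiver.Path b c) :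
    ofPath k p * ofPath k q = ofPath k (p.comp q) := by
  rw [mul_def, mulLin_single ⟨a, b, p⟩ ⟨b, c, q⟩]
  simp [concat]

theorem ofPath_mul_ofPath_of_ne {a b c d : V} (p : Quiver.Path a b) (q : Quiver.Path c d)
    (h : b ≠ c) : ofPath k p * ofPath k q = 0 := by
  rw [mul_def, mulLin_single ⟨a, b, p⟩ ⟨c, d, q⟩]
  simp [concat, h]

/-- Linear maps on the path algebra agree if they agree on paths. -/
theorem lin_ext {N : Type*} [AddCommMonoid N] [Module k N] {f g : PathAlgebra k V →ₗ[k] N}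
    (h : ∀ (a b : V) (p : Quiver.Path a b), f (ofPath k p) = g (ofPath k p)) : f = g := by
  refine Finsupp.lhom_ext' fun p => LinearMap.ext_ring ?_
  exact h p.1 p.2.1 p.2.2

instance : NonUnitalRing (PathAlgebra k V) where
  left_distrib x y z := by simp [mul_def]
  right_distrib x y z := by simp [mul_def]
  zero_mul x := by simp [mul_def]
  mul_zero x := by simp [mul_def]
  mul_assoc x y z := by
    have key : ∀ (a b : V) (p : Quiver.Path a b) (c d : V) (q : Quiver.Path c d)
        (e f : V) (r : Quiver.Path e f),
        ofPath k p * ofPath k q * ofPath k r = ofPath k p * (ofPath k q * ofPath k r) := by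
      intro a b p c d q e f r
      have z0 : ∀ w : PathAlgebra k V, (0 : PathAlgebra k V) * w = 0 := by
        intro w; simp [mul_def]
      have z1 : ∀ w : PathAlgebra k V, w * (0 : PathAlgebra k V) = 0 := by
        intro w; simp [mul_def]
      by_cases h1 : b = c
      · subst h1
        by_cases h2 : d = e
        · subst h2
          simp only [ofPath_mul_ofPath, Quiver.Path.comp_assoc]
        · rw [ofPath_mul_ofPath, ofPath_mul_ofPath_of_ne _ _ h2,
            ofPath_mul_ofPath_of_ne _ _ h2, z1]
      · rw [ofPath_mul_ofPath_of_ne _ _ h1, z0]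
        by_cases h2 : d = e
        · subst h2
          rw [ofPath_mul_ofPath, ofPath_mul_ofPath_of_ne _ _ h1]
        · rw [ofPath_mul_ofPath_of_ne _ _ h2, z1]
    have h1 : ((mulLin k V).compr₂ (mulLin k V)) =
        ((LinearMap.lcomp k (PathAlgebra k V →ₗ[k] PathAlgebra k V) (mulLin k V)).comp
          ((LinearMap.llcomp k _ _ _).comp (mulLin k V))) := by
      refine lin_ext fun a b p => lin_ext fun c d q => lin_ext fun e f r => ?_
      exact key a b p c d q e f r
    exact congrArg (fun φ => φ x y z) h1

variable [Fintype V]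

instance : One (PathAlgebra k V) := ⟨∑ v : V, ofPath k (Quiver.Path.nil : Quiver.Path v v)⟩

theorem one_def :
    (1 : PathAlgebra k V) = ∑ v : V, ofPath k (Quiver.Path.nil : Quiver.Path v v) := rfl

theorem one_mul_aux (x : PathAlgebra k V) : 1 * x = x := by
  have : mulLin k V 1 = LinearMap.id := by
    refine lin_ext fun a b p => ?_
    rw [← mul_def, one_def, Finset.sum_mul, Finset.sum_eq_single a]
    · simp [ofPath_mul_ofPath]
    · intro c _ hc
      exact ofPath_mul_ofPath_of_ne _ _ hc
    · simp
  exact congrArg (fun φ => φ x) this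

theorem mul_one_aux (x : PathAlgebra k V) : x * 1 = x := by
  have : (mulLin k V).flip 1 = LinearMap.id := by
    refine lin_ext fun a b p => ?_
    rw [LinearMap.flip_apply, ← mul_def, one_def, Finset.mul_sum, Finset.sum_eq_single b]
    · simp [ofPath_mul_ofPath]
    · intro c _ hc
      exact ofPath_mul_ofPath_of_ne _ _ hc.symm
    · simp
  exact congrArg (fun φ => φ x) this

instance : Ring (PathAlgebra k V) :=
  { (inferInstance : NonUnitalRing (PathAlgebra k V)) with
    one := 1
    one_mul := one_mul_aux
    mul_one := mul_one_aux }

instance : Algebra k (PathAlgebra k V) :=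
  Algebra.ofModule (fun r x y => by simp [mul_def]) (fun r x y => by simp [mul_def])

end PathAlgebra

/-- The bound quiver algebra `kQ/I`, where `I` is the two-sided ideal generated by `ρ`. -/
abbrev BoundQuiverAlgebra (k : Type u) (V : Type v) [Field k] [Quiver.{v} V] [Fintype V]
    (ρ : Set (PathAlgebra k V)) : Type (max u v) :=
  (TwoSidedIdeal.span ρ).ringCon.Quotient

section Jacobian

variable (k : Type u) {V : Type v} [Field k] [Quiver.{v} V] [Fintype V]

/-- The product in the path algebra of a list of arrows. -/
def wordProd (w : List (Σ a b : V, a ⟶ b)) : PathAlgebra k V :=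
  (w.map fun e => PathAlgebra.ofArrow k e.2.2).prod

open Classical in
/-- The cyclic derivative `∂_e` of an oriented cycle `w = e₁ e₂ ⋯ eₙ` (with `n ≥ 2`): the sum, over
all positions `i` with `eᵢ = e`, of the paths `eᵢ₊₁ ⋯ eₙ e₁ ⋯ eᵢ₋₁`. -/
def cyclicDerivative (e : Σ a b : V, a ⟶ b) (w : List (Σ a b : V, a ⟶ b)) : PathAlgebra k V :=
  ∑ i : Fin w.length, if w.get i = e then wordProd k (w.rotate i).tail else 0

/-- The Jacobian algebra of a quiver with the potential `∑ₜ W t`, a finite sum of oriented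
cycles: the quotient of the path algebra by the cyclic derivatives with respect to all arrows. -/
abbrev JacobianAlgebra {ι : Type} [Fintype ι] (W : ι → List (Σ a b : V, a ⟶ b)) :
    Type (max u v) :=
  BoundQuiverAlgebra k V (Set.range fun e : (Σ a b : V, a ⟶ b) => ∑ t, cyclicDerivative k e (W t))

end Jacobian

/-! ### Trivial extensions -/

/-- The dual `D(A) = Hom_k(A, k)`, considered as an `A`-`A`-bimodule. -/
def DualBimodule (k : Type u) (A : Type v) [Field k] [Ring A] [Algebra k A] : Type (max u v) :=
  Module.Dual k A

namespace DualBimodule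

variable (k : Type u) (A : Type v) [Field k] [Ring A] [Algebra k A]

instance : AddCommGroup (DualBimodule k A) := inferInstanceAs (AddCommGroup (Module.Dual k A))

instance : Module k (DualBimodule k A) := inferInstanceAs (Module k (Module.Dual k A))

/-- The left action `(a f)(x) = f (x a)`. -/
instance : Module A (DualBimodule k A) where
  smul a f := LinearMap.comp (show Module.Dual k A from f) (LinearMap.mulRight k a)
  one_smul f := LinearMap.ext fun x => congrArg (show Module.Dual k A from f) (mul_one x)
  mul_smul a b f :=
    LinearMap.ext fun x => congrArg (show Module.Dual k A from f) (mul_assoc x a b).symm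
  smul_zero _ := rfl
  smul_add _ _ _ := rfl
  add_smul a b f := LinearMap.ext fun x =>
    (congrArg (show Module.Dual k A from f) (mul_add x a b)).trans (LinearMap.map_add _ _ _)
  zero_smul f := LinearMap.ext fun x =>
    (congrArg (show Module.Dual k A from f) (mul_zero x)).trans (LinearMap.map_zero _)

/-- The right action `(f a)(x) = f (a x)`. -/
instance : Module Aᵐᵒᵖ (DualBimodule k A) where
  smul a f := LinearMap.comp (show Module.Dual k A from f) (LinearMap.mulLeft k a.unop)
  one_smul f := LinearMap.ext fun x => congrArg (show Module.Dual k A from f) (one_mul x)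
  mul_smul a b f :=
    LinearMap.ext fun x => congrArg (show Module.Dual k A from f) (mul_assoc b.unop a.unop x)
  smul_zero _ := rfl
  smul_add _ _ _ := rfl
  add_smul a b f := LinearMap.ext fun x =>
    (congrArg (show Module.Dual k A from f) (add_mul a.unop b.unop x)).trans
      (LinearMap.map_add _ _ _)
  zero_smul f := LinearMap.ext fun x =>
    (congrArg (show Module.Dual k A from f) (zero_mul x)).trans (LinearMap.map_zero _)

instance : SMulCommClass A Aᵐᵒᵖ (DualBimodule k A) where
  smul_comm a b f :=
    LinearMap.ext fun x => congrArg (show Module.Dual k A from f) (mul_assoc b.unop x a).symm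

instance : IsScalarTower k A (DualBimodule k A) where
  smul_assoc c a f := LinearMap.ext fun x =>
    (congrArg (show Module.Dual k A from f) (mul_smul_comm c x a)).trans (LinearMap.map_smul _ _ _)

instance : IsScalarTower k Aᵐᵒᵖ (DualBimodule k A) where
  smul_assoc c a f := LinearMap.ext fun x =>
    (congrArg (show Module.Dual k A from f) (smul_mul_assoc c a.unop x)).trans
      (LinearMap.map_smul _ _ _)

end DualBimodule

/-- The trivial extension `T(A) = A ⋉ D(A)`, with `(a, f) (b, g) = (a b, a g + f b)`. -/
abbrev TrivialExtension (k : Type u) (A : Type v) [Field k] [Ring A] [Algebra k A] :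
    Type (max u v) :=
  TrivSqZeroExt A (DualBimodule k A)

/-! ### Brauer graphs and Brauer graph algebras -/

/-- A finite graph (loops and multiple edges allowed) with a cyclic ordering of the edge ends
around each vertex and a multiplicity at each vertex. The graph is given by its half-edges:
an edge is a pair `{h, opp h}`, and a vertex is a cycle of `next`, where `next h` is the direct
successor of `h` in the cyclic ordering around the vertex of `h`. -/
structure BrauerGraph where
  HalfEdge : Type
  finite : Fintype HalfEdge
  /-- the other end of the same edge -/
  opp : Equiv.Perm HalfEdge
  opp_opp : ∀ h, opp (opp h) = h
  opp_ne : ∀ h, opp h ≠ h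
  next : Equiv.Perm HalfEdge
  mult : Quotient (Equiv.Perm.SameCycle.setoid next) → ℕ+

namespace BrauerGraph

variable (G : BrauerGraph)

instance : Fintype G.HalfEdge := G.finite

/-- The edges of the Brauer graph. -/
def Edge : Type := Quotient (Equiv.Perm.SameCycle.setoid G.opp)

/-- The vertices of the Brauer graph. -/
def Vertex : Type := Quotient (Equiv.Perm.SameCycle.setoid G.next)

variable {G} in
/-- The edge to which a half-edge belongs. -/
def edge (h : G.HalfEdge) : G.Edge := Quotient.mk (Equiv.Perm.SameCycle.setoid G.opp) h

variable {G} in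
/-- The vertex at which a half-edge is attached. -/
def vertex (h : G.HalfEdge) : G.Vertex := Quotient.mk (Equiv.Perm.SameCycle.setoid G.next) h

instance : Finite G.Edge := inferInstanceAs (Finite (Quotient _))

instance : Fintype G.Edge := Fintype.ofFinite _

variable {G}

/-- The valency of the vertex of `h`, i.e. the length of the cycle of `next` through `h`. -/
def valency (h : G.HalfEdge) : ℕ := Function.minimalPeriod G.next h

/-- The multiplicity of the vertex of `h`. -/
def multAt (h : G.HalfEdge) : ℕ := G.mult (vertex h)

/-- The vertex of `h` is a leaf vertex of multiplicity one. -/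
def IsTruncated (h : G.HalfEdge) : Prop := G.next h = h ∧ multAt h = 1

theorem multAt_next (h : G.HalfEdge) : multAt (G.next h) = multAt h := by
  have : vertex (G.next h) = vertex h := Quotient.sound' ((Equiv.Perm.SameCycle.refl _ _).apply_left)
  rw [multAt, this, multAt]

theorem isTruncated_next_iff (h : G.HalfEdge) : IsTruncated (G.next h) ↔ IsTruncated h := by
  simp [IsTruncated, multAt_next]

/-- The half-edges `h` that carry an arrow, from the edge of `h` to the edge of `next h`. A leaf
vertex of multiplicity one carries no arrow. The only exception is an edge both of whose ends are
such leaf vertices: there both ends carry a loop, and the relations below identify these two loops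
and make their square zero, so that the algebra of this graph is `k[x]/(x²)`. -/
def CarriesArrow (h : G.HalfEdge) : Prop := IsTruncated h → IsTruncated (G.opp h)

theorem carriesArrow_next {h : G.HalfEdge} (hh : CarriesArrow h) : CarriesArrow (G.next h) := by
  intro ht
  have ht' := (isTruncated_next_iff h).1 ht
  rw [ht'.1]
  exact hh ht'

variable (G)

/-- The arrows of the quiver. -/
abbrev Arrow : Type := {h : G.HalfEdge // CarriesArrow h}

/-- The quiver of a Brauer graph: its vertices are the edges of the graph. -/
instance : Quiver.{0} G.Edge where
  Hom i j := {a : G.Arrow // edge a.1 = i ∧ edge (G.next a.1) = j}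

variable {G}

/-- The next arrow in the cycle around a vertex. -/
def Arrow.next (a : G.Arrow) : G.Arrow := ⟨G.next a.1, carriesArrow_next a.2⟩

variable (k : Type u) [Field k]

/-- An arrow as an element of the path algebra. -/
def arrowElt (a : G.Arrow) : PathAlgebra k G.Edge :=
  PathAlgebra.ofArrow k
    (show edge a.1 ⟶ edge (G.next a.1) from ⟨a, rfl, rfl⟩)

/-- The cycle around the vertex of `a` that starts with the arrow `a`. -/
def cycle (a : G.Arrow) : PathAlgebra k G.Edge :=
  ((List.range (valency a.1)).map fun i => arrowElt k (Arrow.next^[i] a)).prod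

variable (G) in
/-- The relations of a Brauer graph algebra. -/
inductive Relation : PathAlgebra k G.Edge → Prop
  /-- The two powers of cycles that start at the same edge agree. -/
  | commute (a b : G.Arrow) (hab : b.1 = G.opp a.1) :
      Relation (cycle k a ^ multAt a.1 - cycle k b ^ multAt b.1)
  /-- If only one end of an edge carries an arrow, then the power of the cycle at this end,
  followed by its first arrow, is zero. -/
  | leaf (a : G.Arrow) (ha : ¬ CarriesArrow (G.opp a.1)) :
      Relation (cycle k a ^ multAt a.1 * arrowElt k a)
  /-- The composition of two arrows is zero unless they are consecutive in a cycle around a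
  vertex: `a` arrives at the end `next a` of an edge, and `b` leaves from the other end. -/
  | zero (a b : G.Arrow) (hab : b.1 = G.opp (G.next a.1)) :
      Relation (arrowElt k a * arrowElt k b)

variable (G) in
/-- The Brauer graph algebra. -/
abbrev algebra : Type u := BoundQuiverAlgebra k G.Edge {x | Relation G k x}

end BrauerGraph

/-! ### Triangulated surfaces -/

/-- A pattern for gluing finitely many oriented triangles along sides. The triangle `t` has
corners `0, 1, 2` in counterclockwise order, and `(t, i)` is its side from corner `i` to corner
`i + 1`. A side `h` with `glue h = h` is free, and any other side `h` is glued to `glue h`,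
reversing the direction. -/
structure TriangleGluing where
  numTriangles : ℕ
  glue : Equiv.Perm (Fin numTriangles × Fin 3)
  glue_glue : ∀ h, glue (glue h) = h

namespace TriangleGluing

variable (X : TriangleGluing)

/-- The sides of the triangles. -/
abbrev Side : Type := Fin X.numTriangles × Fin 3

/-- The points of the disjoint union of the triangles, in barycentric coordinates. -/
abbrev Point : Type := Fin X.numTriangles × stdSimplex ℝ (Fin 3)

variable {X}

/-- The next side of the same triangle, counterclockwise: it starts where `h` ends. -/
def rot (h : X.Side) : X.Side := (h.1, h.2 + 1)

/-- The previous side of the same triangle: it ends where `h` starts. -/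
def rotInv (h : X.Side) : X.Side := (h.1, h.2 + 2)

/-- The point `p` lies on the (closed) side `h`. -/
def OnSide (p : X.Point) (h : X.Side) : Prop := p.1 = h.1 ∧ p.2.1 (h.2 + 2) = 0

/-- The points `p` and `q` are identified by gluing a side `h` to the side `glue h`. -/
def Glued (p q : X.Point) : Prop :=
  ∃ h : X.Side, X.glue h ≠ h ∧ OnSide p h ∧ OnSide q (X.glue h) ∧
    p.2.1 h.2 = q.2.1 ((X.glue h).2 + 1) ∧ p.2.1 (h.2 + 1) = q.2.1 (X.glue h).2

variable (X) in
/-- The sides that are glued to another side. Such a side `h` runs along an arc, and it is also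
used to denote the end of this arc at the point where `h` ends; the other end of the arc is then
given by `glue h`. -/
abbrev InnerSide : Type := {h : X.Side // X.glue h ≠ h}

instance : Fintype X.InnerSide := Fintype.ofFinite {h : X.Side // X.glue h ≠ h}

/-- The gluing, as a permutation of the inner sides. -/
def opp : Equiv.Perm X.InnerSide :=
  X.glue.subtypePerm (p := fun h => X.glue h ≠ h) fun h => by simp

theorem opp_val (h : X.InnerSide) : (opp h).1 = X.glue h.1 := rfl

open Classical in
/-- Turn clockwise, around the point where the side `h` ends, across the triangle of `h` to its
next side; stay if this next side is free. -/
def turn (h : X.InnerSide) : X.InnerSide :=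
  if hs : X.glue (rot h.1) ≠ rot h.1 then opp ⟨rot h.1, hs⟩ else h

open Classical in
/-- Turn counterclockwise, around the point where the side `h` ends, across the triangle on the
other side of the arc; stay if the side reached in this way is free. -/
def turnBack (h : X.InnerSide) : X.InnerSide :=
  if hs : X.glue (rotInv (opp h).1) ≠ rotInv (opp h).1 then ⟨rotInv (opp h).1, hs⟩ else h

open Classical in
/-- The clockwise successor of an arc end around a marked point: the next arc across the triangle
of `h`, if there is one; otherwise the boundary is reached, and the successor is the first
arc end at the same marked point, reached by turning back as far as possible. -/
def nextFun (h : X.InnerSide) : X.InnerSide :=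
  if X.glue (rot h.1) ≠ rot h.1 then turn h else turnBack^[Fintype.card X.InnerSide] h

theorem rotInv_rot (h : X.Side) : rotInv (rot h) = h := by
  obtain ⟨t, i⟩ := h
  simp only [rot, rotInv, Prod.mk.injEq, true_and]
  fin_cases i <;> rfl

theorem rot_rotInv (h : X.Side) : rot (rotInv h) = h := by
  obtain ⟨t, i⟩ := h
  simp only [rot, rotInv, Prod.mk.injEq, true_and]
  fin_cases i <;> rfl

theorem opp_opp (h : X.InnerSide) : opp (opp h) = h := Subtype.ext (X.glue_glue h.1)

theorem turnBack_turn {h : X.InnerSide} (hs : X.glue (rot h.1) ≠ rot h.1) :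
    turnBack (turn h) = h := by
  have h1 : opp (turn h) = ⟨rot h.1, hs⟩ := by rw [turn, dif_pos hs, opp_opp]
  have h2 : rotInv (opp (turn h)).1 = h.1 := by rw [h1, rotInv_rot]
  rw [turnBack, dif_pos (by rw [h2]; exact h.2)]
  exact Subtype.ext h2

theorem nextFun_surjective : Function.Surjective (nextFun : X.InnerSide → X.InnerSide) := by
  classical
  intro y
  by_cases hy : X.glue (rotInv (opp y).1) ≠ rotInv (opp y).1
  · refine ⟨⟨rotInv (opp y).1, hy⟩, ?_⟩
    have hr : rot (rotInv (opp y).1) = (opp y).1 := rot_rotInv _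
    have hs : X.glue (rot (rotInv (opp y).1)) ≠ rot (rotInv (opp y).1) := by
      rw [hr]; exact (opp y).2
    rw [nextFun, if_pos hs, turn, dif_pos hs]
    have : (⟨rot (rotInv (opp y).1), hs⟩ : X.InnerSide) = opp y := Subtype.ext hr
    rw [this, opp_opp]
  · have hfix : turnBack y = y := by rw [turnBack, dif_neg hy]
    have hnot : ∀ z : X.InnerSide, X.glue (rot z.1) ≠ rot z.1 → turn z ≠ y := by
      rintro z hz rfl
      refine hy ?_
      have h1 : opp (turn z) = ⟨rot z.1, hz⟩ := by rw [turn, dif_pos hz, opp_opp]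
      have h2 : rotInv (opp (turn z)).1 = z.1 := by rw [h1, rotInv_rot]
      rw [h2]
      exact z.2
    set N := Fintype.card X.InnerSide with hN
    have back : ∀ m, (∀ i < m, X.glue (rot (turn^[i] y).1) ≠ rot (turn^[i] y).1) →
        turnBack^[m] (turn^[m] y) = y := by
      intro m
      induction m with
      | zero => intro _; rfl
      | succ m ih =>
        intro hm
        rw [Function.iterate_succ_apply, Function.iterate_succ_apply',
          turnBack_turn (hm m (Nat.lt_succ_self m))]
        exact ih fun i hi => hm i (Nat.lt_succ_of_lt hi)
    have hex : ∃ m, m ≤ N ∧ ¬ X.glue (rot (turn^[m] y).1) ≠ rot (turn^[m] y).1 := by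
      by_contra hcon
      push Not at hcon
      have hcard : Fintype.card X.InnerSide < Fintype.card (Fin (N + 1)) := by simp [hN]
      obtain ⟨i, j, hij, he⟩ := Fintype.exists_ne_map_eq_of_card_lt
        (fun i : Fin (N + 1) => turn^[i.1] y) hcard
      have main : ∀ i j : ℕ, i < j → j ≤ N → turn^[i] y = turn^[j] y → False := by
        intro i j hlt hj he
        have e1 := back i fun l hl => hcon l (by omega)
        rw [he] at e1
        have e2 : ∀ l, l ≤ j → turnBack^[l] (turn^[j] y) = turn^[j - l] y := by
          intro l
          induction l with
          | zero => intro _; rfl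
          | succ l ih =>
            intro hl
            rw [Function.iterate_succ_apply', ih (by omega)]
            have : j - l = (j - (l + 1)) + 1 := by omega
            rw [this, Function.iterate_succ_apply', turnBack_turn (hcon _ (by omega))]
        rw [e2 i hlt.le] at e1
        have : j - i = (j - i - 1) + 1 := by omega
        rw [this, Function.iterate_succ_apply'] at e1
        exact hnot _ (hcon _ (by omega)) e1
      rcases lt_or_gt_of_ne (fun h => hij (Fin.ext h) : i.1 ≠ j.1) with h | h
      · exact main _ _ h (Nat.lt_succ_iff.1 j.2) he
      · exact main _ _ h (Nat.lt_succ_iff.1 i.2) he.symm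
    let m := Nat.find hex
    obtain ⟨hm, hm'⟩ := Nat.find_spec hex
    refine ⟨turn^[m] y, ?_⟩
    rw [nextFun, if_neg hm', ← hN, ← Nat.sub_add_cancel hm, Function.iterate_add_apply,
      back]
    · exact Function.iterate_fixed hfix _
    · intro i hi hi'
      exact Nat.find_min hex hi ⟨by omega, fun h => h hi'⟩

/-- The clockwise cyclic ordering of the arc ends around the marked points. -/
def next : Equiv.Perm X.InnerSide :=
  Equiv.ofBijective nextFun (Finite.surjective_iff_bijective.1 nextFun_surjective)

variable (X)

/-- The Brauer graph given by the arcs, with the clockwise cyclic ordering of the arc ends around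
each marked point, and with multiplicity one at every vertex. -/
def brauerGraph : BrauerGraph where
  HalfEdge := X.InnerSide
  finite := inferInstance
  opp := opp
  opp_opp := opp_opp
  opp_ne h := fun e => h.2 (congrArg Subtype.val e)
  next := next
  mult _ := 1

/-- The arcs of the triangulation: pairs of glued sides. -/
def Arc : Type := Quotient (Equiv.Perm.SameCycle.setoid (opp (X := X)))

variable {X} in
/-- The arc along which an inner side runs. -/
def arc (h : X.InnerSide) : X.Arc := Quotient.mk (Equiv.Perm.SameCycle.setoid opp) h

instance : Finite X.Arc := inferInstanceAs (Finite (Quotient _))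

instance : Fintype X.Arc := Fintype.ofFinite _

/-- The angles of triangles between two arcs, given by a side `h` such that `h` and the
next side `rot h` both run along arcs. -/
abbrev Angle : Type := {h : X.Side // X.glue h ≠ h ∧ X.glue (rot h) ≠ rot h}

/-- The quiver of the triangulation: its vertices are the arcs, and every angle of a triangle
between two arcs gives an arrow, from a side of the triangle to the counterclockwise next side
(equivalently, clockwise around the marked point at which the two sides meet). -/
instance : Quiver.{0} X.Arc where
  Hom i j := {a : X.Angle // arc ⟨a.1, a.2.1⟩ = i ∧ arc ⟨rot a.1, a.2.2⟩ = j}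

/-- The internal triangles: those with three sides on arcs. -/
abbrev InternalTriangle : Type := {t : Fin X.numTriangles // ∀ i, X.glue (t, i) ≠ (t, i)}

instance : Fintype X.InternalTriangle :=
  Fintype.ofFinite {t : Fin X.numTriangles // ∀ i, X.glue (t, i) ≠ (t, i)}

variable {X} in
/-- The arrow in an internal triangle from side `i` to side `i + 1`. -/
def InternalTriangle.arrow (t : X.InternalTriangle) (i : Fin 3) : Σ a b : X.Arc, a ⟶ b :=
  ⟨arc ⟨(t.1, i), t.2 i⟩, arc ⟨(t.1, i + 1), t.2 (i + 1)⟩,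
    ⟨⟨(t.1, i), t.2 i, t.2 (i + 1)⟩, rfl, rfl⟩⟩

/-- The potential: the sum over all internal triangles of the oriented 3-cycle in the triangle. -/
def potential (t : X.InternalTriangle) : List (Σ a b : X.Arc, a ⟶ b) :=
  [t.arrow 0, t.arrow 1, t.arrow 2]

/-- The Jacobian algebra of the triangulation. -/
abbrev jacobianAlgebra (k : Type u) [Field k] : Type u := JacobianAlgebra k X.potential

end TriangleGluing

/-- An ideal triangulation of the surface `S` with the set `M` of marked points: arcs that cut
`S` into finitely many triangles with vertices in `M`, i.e. `S` is obtained, by means of the map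
`chart`, from oriented triangles by gluing pairs of sides, reversing directions. The triangles
carry the orientation of `S`; the arcs are the images of the glued sides, the
boundary segments are the images of the free sides, and `M` is the image of the set of corners. -/
structure IdealTriangulation (S : Type v) [TopologicalSpace S] (M : Set S) extends
    TriangleGluing where
  chart : toTriangleGluing.Point → S
  isQuotientMap_chart : Topology.IsQuotientMap chart
  chart_eq_iff : ∀ p q, chart p = chart q ↔ Relation.EqvGen TriangleGluing.Glued p q
  image_corners : chart '' {p | ∃ i, p.2.1 i = 1} = M

/-- The boundary of the surface: the union of the free sides of the triangles. -/
def IdealTriangulation.boundary {S : Type v} [TopologicalSpace S] {M : Set S}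
    (T : IdealTriangulation S M) : Set S :=
  T.chart '' {p | ∃ h, T.glue h = h ∧ TriangleGluing.OnSide p h}

end

noncomputable section

universe u v w

/-! Since every marked point lies on the boundary, turning clockwise around it meets each arc end
there and then the boundary. The cyclic order at a vertex of the Brauer graph is thus cut at one
place. This cut links the two algebras: the arrows of the Jacobian algebra `A` are those of the
Brauer graph that do not cross a cut, and in both algebras two arrows compose to zero unless they
are consecutive around a vertex. In `A` this follows from the cyclic derivatives: inside an internal
triangle they kill each product of two successive arrows.

Hence `A` has as basis the trivial paths and the paths around a marked point that stay on one side
of the cut. They span because the relations kill everything else, and they are independent because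
the relations can be realised on the free module on these paths (`isGentleSystem_act`).

In `T(A)`, let an arrow across a cut be the linear form dual to the longest path at that vertex.
Multiplying a dual path by an arrow strips this arrow from the path, so a word that crosses the cut
equals the form dual to the complementary path (`word_extArrow_of_lt`), and a full cycle equals the
form dual to the trivial path of its edge. The latter depends only on the edge, which is the
relation identifying the cycles at its two ends. So there is a homomorphism from `B_T` to `T(A)`. It
is bijective because `B_T` is spanned by the paths before the cut and their complements
(`IsBrauerSystem.span_eq_top`), and these go to a basis of `A` together with its dual basis.

To treat leaf vertices uniformly, every half-edge is given an arrow. At a leaf without an arrow in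
the quiver of `B_T`, this arrow is the cycle at the other end of the edge; the relation `C α = 0`
then becomes a case of the vanishing of non-consecutive products. -/

/-- A finite ribbon graph with half-edges `H` and edges `E`, cut at one place around each vertex:
`dist h` is the number of steps of `next` from `h` to the last half-edge before the cut. -/
structure CutRibbonGraph (H E : Type) where
  opp : H → H
  opp_ne : ∀ h, opp h ≠ h
  next : Equiv.Perm H
  edge : H → E
  edge_surjective : Function.Surjective edge
  edge_eq_iff : ∀ g h, edge g = edge h ↔ g = h ∨ g = opp h
  dist : H → ℕ
  dist_next : ∀ h, dist h ≠ 0 → dist (next h) + 1 = dist h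
  iterate_dist_next : ∀ h, dist h = 0 → next^[dist (next h)] (next h) = h

/-! ### Walking around a vertex of a cut ribbon graph -/

namespace CutRibbonGraph

variable {H E : Type} (Γ : CutRibbonGraph H E)

theorem edge_opp (h : H) : Γ.edge (Γ.opp h) = Γ.edge h :=
  (Γ.edge_eq_iff _ _).2 (Or.inr rfl)

/-- The number of half-edges around the vertex of `h`. -/
def val (h : H) : ℕ := Function.minimalPeriod Γ.next h

theorem iterate_val (h : H) : Γ.next^[Γ.val h] h = h := Function.iterate_minimalPeriod

theorem dist_iterate {h : H} {j : ℕ} (hj : j ≤ Γ.dist h) :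
    Γ.dist (Γ.next^[j] h) = Γ.dist h - j := by
  induction j with
  | zero => rfl
  | succ j ih =>
    have h1 := ih (by omega)
    have h2 := Γ.dist_next (Γ.next^[j] h) (by omega)
    rw [Function.iterate_succ_apply']
    omega

/-- From `h` one walks to the last half-edge before the cut, and the loop that starts just after the
cut leads back to it. This gives periodicity without finiteness of `H`. -/
theorem iterate_period (h : H) : Γ.next^[Γ.dist (Γ.next^[Γ.dist h + 1] h) + 1] h = h := by
  have h0 : Γ.dist (Γ.next^[Γ.dist h] h) = 0 := by rw [Γ.dist_iterate le_rfl]; omega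
  have h1 := Γ.iterate_dist_next _ h0
  rw [← Function.iterate_succ_apply' Γ.next (Γ.dist h) h, ← Function.iterate_add_apply] at h1
  -- As `next` is injective, periodicity may be tested at the last half-edge before the cut.
  apply (Γ.next.injective.iterate (Γ.dist h))
  rw [← Function.iterate_add_apply]
  exact Eq.trans (congrArg (fun n => Γ.next^[n] h) (by rw [Nat.succ_eq_add_one]; omega)) h1

theorem mem_periodicPts (h : H) : h ∈ Function.periodicPts Γ.next :=
  ⟨_, by omega, Γ.iterate_period h⟩

theorem val_pos (h : H) : 0 < Γ.val h :=
  Function.minimalPeriod_pos_of_mem_periodicPts (Γ.mem_periodicPts h)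

theorem val_iterate (h : H) (n : ℕ) : Γ.val (Γ.next^[n] h) = Γ.val h :=
  Function.minimalPeriod_apply_iterate (Γ.mem_periodicPts h) n

theorem val_next (h : H) : Γ.val (Γ.next h) = Γ.val h := Γ.val_iterate h 1

theorem dist_lt_val (h : H) : Γ.dist h < Γ.val h := by
  by_contra hc
  have h1 := Γ.dist_iterate (h := h) (j := Γ.val h) (by omega)
  rw [Γ.iterate_val] at h1
  have := Γ.val_pos h
  omega

theorem val_eq {h : H} (h0 : Γ.dist h = 0) : Γ.val h = Γ.dist (Γ.next h) + 1 := by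
  apply le_antisymm
  · apply Function.IsPeriodicPt.minimalPeriod_le (by omega)
    have := Γ.iterate_dist_next h h0
    rwa [← Function.iterate_succ_apply] at this
  · have := Γ.dist_lt_val (Γ.next h)
    rw [Γ.val_next] at this
    omega

/-- Beyond the cut, the distance jumps to the maximal value and decreases again. -/
theorem dist_iterate_of_lt {h : H} {n : ℕ} (h1 : Γ.dist h < n) (h2 : n ≤ Γ.val h) :
    Γ.dist (Γ.next^[n] h) = Γ.val h + Γ.dist h - n := by
  obtain ⟨j, rfl⟩ := Nat.exists_eq_add_of_le (Nat.succ_le_of_lt h1)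
  have h0 : Γ.dist (Γ.next^[Γ.dist h] h) = 0 := by rw [Γ.dist_iterate le_rfl]; omega
  have hv := Γ.val_eq h0
  rw [← Function.iterate_succ_apply' Γ.next (Γ.dist h) h, Γ.val_iterate] at hv
  rw [add_comm, Function.iterate_add_apply, Γ.dist_iterate (by omega)]
  omega

/-! ### Words of consecutive arrows, gentle and Brauer systems -/

section Words

variable {R : Type*} [Ring R] (a : H → R)

/-- The product of `m` consecutive elements around a vertex, starting with `a h`. -/
def word (h : H) (m : ℕ) : R := ((List.range m).map fun i => a (Γ.next^[i] h)).prod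

@[simp] theorem word_zero (h : H) : Γ.word a h 0 = 1 := rfl

theorem word_succ' (h : H) (m : ℕ) : Γ.word a h (m + 1) = Γ.word a h m * a (Γ.next^[m] h) := by
  simp [word, List.range_succ]

theorem word_succ (h : H) (m : ℕ) : Γ.word a h (m + 1) = a h * Γ.word a (Γ.next h) m := by
  simp [word, List.range_succ_eq_map, Function.comp_def]

@[simp] theorem word_one (h : H) : Γ.word a h 1 = a h := by simp [word]

theorem map_word {S F : Type*} [Ring S] [FunLike F R S] [RingHomClass F R S] (f : F) (h : H)
    (m : ℕ) : f (Γ.word a h m) = Γ.word (fun g => f (a g)) h m := by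
  simp [word, map_list_prod, Function.comp_def]

end Words

section Systems

variable [Fintype E] {R : Type*} [Ring R]

/-- Elements of a ring that represent the trivial paths and the arrows around the vertices, such
that arrows compose to zero unless they are consecutive around a vertex. -/
structure IsArrowSystem (e : E → R) (a : H → R) : Prop where
  idem : CompleteOrthogonalIdempotents e
  source : ∀ h, e (Γ.edge h) * a h = a h
  target : ∀ h, a h * e (Γ.edge (Γ.next h)) = a h
  zero : ∀ h, a h * a (Γ.opp (Γ.next h)) = 0

/-- An arrow system in which the arrows across the cuts vanish. -/
structure IsGentleSystem (e : E → R) (a : H → R) : Prop extends Γ.IsArrowSystem e a where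
  cut : ∀ h, Γ.dist h = 0 → a h = 0

/-- An arrow system in which the cycles at the two ends of each edge agree. -/
structure IsBrauerSystem (e : E → R) (a : H → R) : Prop extends Γ.IsArrowSystem e a where
  cycle : ∀ h, Γ.word a h (Γ.val h) = Γ.word a (Γ.opp h) (Γ.val (Γ.opp h))

variable {Γ} {e : E → R} {a : H → R}

namespace IsArrowSystem

variable (hs : Γ.IsArrowSystem e a)

include hs

theorem idem_mul_of_ne {i : E} {h : H} (hi : i ≠ Γ.edge h) : e i * a h = 0 := by
  rw [← hs.source h, ← mul_assoc, hs.idem.ortho hi, zero_mul]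

theorem mul_idem_of_ne {i : E} {h : H} (hi : Γ.edge (Γ.next h) ≠ i) : a h * e i = 0 := by
  rw [← hs.target h, mul_assoc, hs.idem.ortho hi, mul_zero]

/-- Either the idempotents at the junction are orthogonal, or `h` is one of the two half-edges of
the edge of `next g`; the relation `zero` excludes the one that is not `next g`. -/
theorem mul_eq_zero {g h : H} (hgh : h ≠ Γ.next g) : a g * a h = 0 := by
  by_cases he : Γ.edge h = Γ.edge (Γ.next g)
  · rcases (Γ.edge_eq_iff _ _).1 he with e | e
    · exact absurd e hgh
    · rw [e, hs.zero]
  · rw [← hs.source h, ← mul_assoc, hs.mul_idem_of_ne (Ne.symm he), zero_mul]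

theorem idem_mul_word (h : H) (m : ℕ) :
    e (Γ.edge h) * Γ.word a h (m + 1) = Γ.word a h (m + 1) := by
  rw [word_succ, ← mul_assoc, hs.source]

theorem idem_mul_word_of_ne {i : E} {h : H} (hi : i ≠ Γ.edge h) (m : ℕ) :
    e i * Γ.word a h (m + 1) = 0 := by
  rw [word_succ, ← mul_assoc, hs.idem_mul_of_ne hi, zero_mul]

theorem word_mul_idem (h : H) (m : ℕ) :
    Γ.word a h (m + 1) * e (Γ.edge (Γ.next^[m + 1] h)) = Γ.word a h (m + 1) := by
  rw [word_succ', mul_assoc, Function.iterate_succ_apply', hs.target]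

theorem word_mul_idem_of_ne {i : E} {h : H} {m : ℕ} (hi : Γ.edge (Γ.next^[m + 1] h) ≠ i) :
    Γ.word a h (m + 1) * e i = 0 := by
  rw [Function.iterate_succ_apply'] at hi
  rw [word_succ', mul_assoc, hs.mul_idem_of_ne hi, mul_zero]

theorem mul_word_of_ne {g h : H} (hgh : g ≠ Γ.next h) (m : ℕ) :
    a h * Γ.word a g (m + 1) = 0 := by
  rw [word_succ, ← mul_assoc, hs.mul_eq_zero hgh, zero_mul]

theorem word_mul_of_ne {g h : H} {m : ℕ} (hgh : h ≠ Γ.next^[m + 1] g) :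
    Γ.word a g (m + 1) * a h = 0 := by
  rw [Function.iterate_succ_apply'] at hgh
  rw [word_succ', mul_assoc, hs.mul_eq_zero hgh, mul_zero]

end IsArrowSystem

theorem IsGentleSystem.word_eq_zero (hs : Γ.IsGentleSystem e a) {h : H} {m : ℕ}
    (hm : Γ.dist h < m) : Γ.word a h m = 0 := by
  obtain ⟨j, rfl⟩ := Nat.exists_eq_add_of_le (Nat.succ_le_of_lt hm)
  induction j with
  | zero =>
    have h0 : Γ.dist (Γ.next^[Γ.dist h] h) = 0 := by rw [Γ.dist_iterate le_rfl]; omega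
    rw [add_zero, Nat.succ_eq_add_one, word_succ', hs.cut _ h0, mul_zero]
  | succ j ih =>
    rw [← add_assoc, word_succ', ih (by omega), zero_mul]

/-- An arrow annihilates every cycle. -/
theorem IsBrauerSystem.mul_cycle (hs : Γ.IsBrauerSystem e a) (g h : H) :
    a g * Γ.word a h (Γ.val h) = 0 := by
  have key : ∀ h', h' ≠ Γ.next g → a g * Γ.word a h' (Γ.val h') = 0 := by
    intro h' hne
    obtain ⟨m, hm⟩ := Nat.exists_eq_succ_of_ne_zero (Γ.val_pos h').ne'
    rw [hm]
    exact hs.mul_word_of_ne hne m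
  by_cases hgh : h = Γ.next g
  -- The cycle equals the one at the opposite half-edge, whose first arrow does not continue `a g`.
  · rw [hs.cycle]
    exact key _ (hgh ▸ Γ.opp_ne _)
  · exact key _ hgh

end Systems

/-- A subspace that contains `1` and is stable under left multiplication by generators is
everything. -/
theorem _root_.Submodule.eq_top_of_adjoin_eq_top {k R : Type*} [Field k] [Ring R] [Algebra k R]
    {s : Set R} (hs : Algebra.adjoin k s = ⊤) (N : Submodule k R) (h1 : (1 : R) ∈ N)
    (hN : ∀ x ∈ s, ∀ y ∈ N, x * y ∈ N) : N = ⊤ := by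
  rw [eq_top_iff]
  rintro z -
  have hz : z ∈ Algebra.adjoin k s := by rw [hs]; trivial
  have : ∀ y ∈ N, z * y ∈ N := by
    induction hz using Algebra.adjoin_induction with
    | mem x hx => exact hN x hx
    | algebraMap r => intro y hy; rw [← Algebra.smul_def]; exact N.smul_mem r hy
    | add x y _ _ hx hy => intro w hw; rw [add_mul]; exact N.add_mem (hx w hw) (hy w hw)
    | mul x y _ _ hx hy => intro w hw; rw [mul_assoc]; exact hx _ (hy w hw)
  simpa using this 1 h1

end CutRibbonGraph

/-! ### Regular representation on the paths before the cut -/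

namespace CutRibbonGraph

variable {H E : Type} (Γ : CutRibbonGraph H E)

/-- The paths that do not cross a cut: the trivial paths, and the paths of length `j + 1` that start
at `h`, for `j < dist h`. -/
abbrev PathIndex : Type := E ⊕ Σ h, Fin (Γ.dist h)

/-- The elements given by the paths that do not cross a cut. -/
def pathFamily {R : Type*} [Ring R] (e : E → R) (a : H → R) : Γ.PathIndex → R
  | .inl i => e i
  | .inr ⟨h, j⟩ => Γ.word a h (j + 1)

section Regular

variable (k : Type u) [Field k]

open Classical in
/-- The path of length `m + 1` that starts at `h`, or zero if it crosses a cut. -/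
def basisPath (h : H) (m : ℕ) : Γ.PathIndex →₀ k :=
  if hm : m < Γ.dist h then Finsupp.single (.inr ⟨h, m, hm⟩) 1 else 0

theorem basisPath_of_lt {h : H} {m : ℕ} (hm : m < Γ.dist h) :
    Γ.basisPath k h m = Finsupp.single (.inr ⟨h, m, hm⟩) 1 := dif_pos hm

theorem basisPath_of_le {h : H} {m : ℕ} (hm : Γ.dist h ≤ m) : Γ.basisPath k h m = 0 :=
  dif_neg hm.not_gt

open Classical in
/-- Left multiplication by a trivial path. -/
def actIdem (i : E) : Module.End k (Γ.PathIndex →₀ k) :=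
  Finsupp.linearCombination k fun p => match p with
    | .inl j => if j = i then Finsupp.single (.inl j) 1 else 0
    | .inr ⟨h, j⟩ => if Γ.edge h = i then Γ.basisPath k h j else 0

open Classical in
/-- Left multiplication by an arrow. -/
def actArrow (h : H) : Module.End k (Γ.PathIndex →₀ k) :=
  Finsupp.linearCombination k fun p => match p with
    | .inl j => if j = Γ.edge (Γ.next h) then Γ.basisPath k h 0 else 0
    | .inr ⟨g, j⟩ => if g = Γ.next h then Γ.basisPath k h (j + 1) else 0

open Classical in
theorem actIdem_inl (i j : E) : Γ.actIdem k i (Finsupp.single (.inl j) 1) =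
    if j = i then Finsupp.single (.inl j) 1 else 0 := by
  simp [actIdem]

open Classical in
theorem actIdem_basisPath (i : E) (h : H) (m : ℕ) : Γ.actIdem k i (Γ.basisPath k h m) =
    if Γ.edge h = i then Γ.basisPath k h m else 0 := by
  by_cases hm : m < Γ.dist h
  · rw [Γ.basisPath_of_lt k hm]
    simp [actIdem, Γ.basisPath_of_lt k hm]
  · rw [Γ.basisPath_of_le k (not_lt.1 hm)]
    simp

open Classical in
theorem actArrow_inl (h : H) (j : E) : Γ.actArrow k h (Finsupp.single (.inl j) 1) =
    if j = Γ.edge (Γ.next h) then Γ.basisPath k h 0 else 0 := by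
  simp [actArrow]

-- The case of a path that already crosses the cut is consistent: one step further back the distance
-- to the cut grows by at most one, so the longer path crosses it too.
open Classical in
theorem actArrow_basisPath (h g : H) (m : ℕ) : Γ.actArrow k h (Γ.basisPath k g m) =
    if g = Γ.next h then Γ.basisPath k h (m + 1) else 0 := by
  by_cases hm : m < Γ.dist g
  · rw [Γ.basisPath_of_lt k hm]
    simp [actArrow]
  · rw [Γ.basisPath_of_le k (not_lt.1 hm), map_zero]
    split_ifs with hg
    · subst hg
      rw [Γ.basisPath_of_le k]
      by_cases h0 : Γ.dist h = 0
      · omega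
      · have := Γ.dist_next h h0
        omega
    · rfl

theorem end_ext {N : Type*} [AddCommMonoid N] [Module k N] {f g : (Γ.PathIndex →₀ k) →ₗ[k] N}
    (h1 : ∀ i, f (Finsupp.single (.inl i) 1) = g (Finsupp.single (.inl i) 1))
    (h2 : ∀ h m, f (Γ.basisPath k h m) = g (Γ.basisPath k h m)) : f = g := by
  refine Finsupp.lhom_ext' fun p => LinearMap.ext_ring ?_
  rcases p with i | ⟨h, j, hj⟩
  · exact h1 i
  · have := h2 h j
    rwa [Γ.basisPath_of_lt k hj] at this

variable [Fintype E]

/-- A model in which the relations hold and no path before a cut vanishes. It shows that the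
relations imply no further linear dependence. -/
theorem isGentleSystem_act : Γ.IsGentleSystem (Γ.actIdem k) (Γ.actArrow k) where
  idem := by
    classical
    refine CompleteOrthogonalIdempotents.iff_ortho_complete.2 ⟨fun i j hij => ?_, ?_⟩
    · refine Γ.end_ext k (fun l => ?_) fun h m => ?_
      · simp only [Module.End.mul_apply, actIdem_inl]
        split_ifs with h1
        · subst h1; simp [actIdem_inl, hij.symm]
        · simp
      · simp only [Module.End.mul_apply, actIdem_basisPath]
        split_ifs with h1
        · subst h1; simp [actIdem_basisPath, hij.symm]
        · simp
    · refine Γ.end_ext k (fun l => ?_) fun h m => ?_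
      · simp [LinearMap.sum_apply, actIdem_inl]
      · simp [LinearMap.sum_apply, actIdem_basisPath]
  source h := by
    classical
    refine Γ.end_ext k (fun l => ?_) fun g m => ?_
    · simp only [Module.End.mul_apply, actArrow_inl]
      split_ifs <;> simp [actIdem_basisPath]
    · simp only [Module.End.mul_apply, actArrow_basisPath]
      split_ifs <;> simp [actIdem_basisPath]
  target h := by
    classical
    refine Γ.end_ext k (fun l => ?_) fun g m => ?_
    · simp only [Module.End.mul_apply, actIdem_inl]
      split_ifs with h1
      · rfl
      · simp [actArrow_inl, h1]
    · simp only [Module.End.mul_apply, actIdem_basisPath]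
      split_ifs with h1
      · rfl
      · have : g ≠ Γ.next h := by rintro rfl; exact h1 rfl
        simp [actArrow_basisPath, this]
  zero h := by
    classical
    refine Γ.end_ext k (fun l => ?_) fun g m => ?_
    · simp only [Module.End.mul_apply, actArrow_inl]
      split_ifs <;> simp [actArrow_basisPath, Γ.opp_ne]
    · simp only [Module.End.mul_apply, actArrow_basisPath]
      split_ifs <;> simp [actArrow_basisPath, Γ.opp_ne]
  cut h h0 := by
    classical
    refine Γ.end_ext k (fun l => ?_) fun g m => ?_
    · rw [actArrow_inl, Γ.basisPath_of_le k (by omega)]; simp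
    · rw [actArrow_basisPath, Γ.basisPath_of_le k (by omega)]; simp

/-- The sum of the trivial paths. -/
def basisOne : Γ.PathIndex →₀ k := ∑ i, Finsupp.single (.inl i) 1

theorem actIdem_basisOne (i : E) : Γ.actIdem k i (Γ.basisOne k) = Finsupp.single (.inl i) 1 := by
  classical
  simp [basisOne, actIdem_inl]

theorem word_basisOne (h : H) (m : ℕ) :
    Γ.word (Γ.actArrow k) h (m + 1) (Γ.basisOne k) = Γ.basisPath k h m := by
  classical
  induction m generalizing h with
  | zero => simp [basisOne, actArrow_inl]
  | succ m ih => rw [word_succ, Module.End.mul_apply, ih]; simp [actArrow_basisPath]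

end Regular

/-! ### Independence and spanning of the path families -/

variable {Γ} [Fintype E] {k : Type u} [Field k] {A : Type v} [Ring A] [Algebra k A]
  {e : E → A} {a : H → A}

/-- Evaluating the representation at the sum of the trivial paths turns the family into the standard
basis. -/
theorem linearIndependent_pathFamily
    (f : A →ₐ[k] Module.End k (Γ.PathIndex →₀ k)) (he : ∀ i, f (e i) = Γ.actIdem k i)
    (ha : ∀ h, f (a h) = Γ.actArrow k h) : LinearIndependent k (Γ.pathFamily e a) := by
  let ψ : A →ₗ[k] (Γ.PathIndex →₀ k) :=
    (LinearMap.applyₗ (Γ.basisOne k)).comp f.toLinearMap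
  refine LinearIndependent.of_comp ψ ?_
  have : ψ ∘ Γ.pathFamily e a = fun p => Finsupp.single p (1 : k) := by
    funext p
    rcases p with i | ⟨h, j, hj⟩
    · change f (e i) (Γ.basisOne k) = _
      rw [he, actIdem_basisOne]
    · change f (Γ.word a h (j + 1)) (Γ.basisOne k) = _
      rw [map_word]
      simp only [ha]
      rw [word_basisOne, basisPath_of_lt]
  rw [this]
  exact Finsupp.linearIndependent_single_one k _

/-- The span contains `1`. Left multiplication by a generator sends each path to zero, to itself or
to a path longer by one arrow, which vanishes if it crosses a cut. -/
theorem IsGentleSystem.span_eq_top (hs : Γ.IsGentleSystem e a)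
    (hgen : Algebra.adjoin k (Set.range e ∪ Set.range a) = ⊤) :
    Submodule.span k (Set.range (Γ.pathFamily e a)) = ⊤ := by
  set N := Submodule.span k (Set.range (Γ.pathFamily e a)) with hN
  have he : ∀ i, e i ∈ N := fun i => Submodule.subset_span ⟨.inl i, rfl⟩
  have hw : ∀ h m, Γ.word a h (m + 1) ∈ N := by
    intro h m
    by_cases hm : m < Γ.dist h
    · exact Submodule.subset_span ⟨.inr ⟨h, m, hm⟩, rfl⟩
    · rw [hs.word_eq_zero (by omega)]
      exact N.zero_mem
  refine Submodule.eq_top_of_adjoin_eq_top hgen N ?_ ?_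
  · rw [← hs.idem.complete]
    exact N.sum_mem fun i _ => he i
  · rintro x hx y hy
    suffices N ≤ N.comap (LinearMap.mulLeft k x) from this hy
    conv_lhs => rw [hN]
    rw [Submodule.span_le]
    rintro _ ⟨p, rfl⟩
    change x * _ ∈ N
    rcases hx with ⟨i, rfl⟩ | ⟨h, rfl⟩ <;> rcases p with l | ⟨g, j⟩ <;> simp only [pathFamily]
    · by_cases hil : i = l
      · subst hil; rw [(hs.idem.idem i).eq]; exact he i
      · rw [hs.idem.ortho hil]; exact N.zero_mem
    · by_cases hil : i = Γ.edge g
      · subst hil; rw [hs.idem_mul_word]; exact hw _ _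
      · rw [hs.idem_mul_word_of_ne hil]; exact N.zero_mem
    · by_cases hil : Γ.edge (Γ.next h) = l
      · subst hil; rw [hs.target, ← Γ.word_one a h]; exact hw h 0
      · rw [hs.mul_idem_of_ne hil]; exact N.zero_mem
    · by_cases hg : g = Γ.next h
      · subst hg; rw [← Γ.word_succ]; exact hw _ _
      · rw [hs.mul_word_of_ne hg]; exact N.zero_mem

/-- The complements, in the cycles around the vertices, of the paths that do not cross a cut: the
complement of a trivial path is a whole cycle. -/
def crossFamily (Γ : CutRibbonGraph H E) {R : Type*} [Ring R] (a : H → R) : Γ.PathIndex → R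
  | .inl i => Γ.word a (Function.surjInv Γ.edge_surjective i)
      (Γ.val (Function.surjInv Γ.edge_surjective i))
  | .inr ⟨g, j⟩ => Γ.word a (Γ.next^[j.1 + 1] g) (Γ.val g - (j + 1))

theorem IsBrauerSystem.cycle_eq (hs : Γ.IsBrauerSystem e a) {g h : H} (hgh : Γ.edge g = Γ.edge h) :
    Γ.word a g (Γ.val g) = Γ.word a h (Γ.val h) := by
  rcases (Γ.edge_eq_iff _ _).1 hgh with rfl | rfl
  · rfl
  · exact (hs.cycle h).symm

/-- Words longer than a full cycle vanish by `mul_cycle`, so words of length at most the valency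
suffice. Such a word is a path before the cut, a full cycle, or a word whose complement in its cycle
is a path before the cut. The family has twice as many members as there are path indices, the size
needed for `T(A)`. -/
theorem IsBrauerSystem.span_eq_top (hs : Γ.IsBrauerSystem e a)
    (hgen : Algebra.adjoin k (Set.range e ∪ Set.range a) = ⊤) :
    Submodule.span k (Set.range (Sum.elim (Γ.pathFamily e a) (Γ.crossFamily a))) = ⊤ := by
  set N := Submodule.span k (Set.range (Sum.elim (Γ.pathFamily e a) (Γ.crossFamily a))) with hN
  have he : ∀ i, e i ∈ N := fun i => Submodule.subset_span ⟨.inl (.inl i), rfl⟩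
  have hc : ∀ h, Γ.word a h (Γ.val h) ∈ N := by
    intro h
    rw [hs.cycle_eq (Function.surjInv_eq Γ.edge_surjective (Γ.edge h)).symm]
    exact Submodule.subset_span ⟨.inr (.inl (Γ.edge h)), rfl⟩
  have hw : ∀ h m, m < Γ.val h → Γ.word a h (m + 1) ∈ N := by
    intro h m hmv
    by_cases hm : m < Γ.dist h
    · exact Submodule.subset_span ⟨.inl (.inr ⟨h, m, hm⟩), rfl⟩
    by_cases hv : m + 1 = Γ.val h
    · rw [hv]; exact hc h
    have hd := Γ.dist_iterate_of_lt (h := h) (n := m + 1) (by omega) (by omega)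
    -- The complement starts where the word ends. The final `- 1` appears because the index `j`
    -- stands for a path of length `j + 1`.
    refine Submodule.subset_span ⟨.inr (.inr ⟨Γ.next^[m + 1] h, Γ.val h - (m + 1) - 1, ?_⟩), ?_⟩
    · rw [hd]; omega
    · simp only [Sum.elim_inr, crossFamily]
      rw [← Function.iterate_add_apply, Γ.val_iterate]
      have h1 : Γ.val h - (m + 1) - 1 + 1 + (m + 1) = Γ.val h := by omega
      have h2 : Γ.val h - (Γ.val h - (m + 1) - 1 + 1) = m + 1 := by omega
      rw [h1, h2, Γ.iterate_val]
  have hcw : ∀ p, (∃ i, Γ.crossFamily a p = Γ.word a i (Γ.val i)) ∨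
      ∃ g m, m + 1 < Γ.val g ∧ Γ.crossFamily a p = Γ.word a g (m + 1) := by
    rintro (i | ⟨g, j, hj⟩)
    · exact .inl ⟨_, rfl⟩
    · have := Γ.dist_lt_val g
      refine .inr ⟨Γ.next^[j + 1] g, Γ.val g - (j + 1) - 1, ?_, ?_⟩
      · rw [Γ.val_iterate]; omega
      · simp only [crossFamily]
        congr 1
        omega
  have hNspan : ∀ x : A, (∀ i, x * e i ∈ N) → (∀ h, x * Γ.word a h (Γ.val h) ∈ N) →
      (∀ h m, m + 1 < Γ.val h → x * Γ.word a h (m + 1) ∈ N) → ∀ y ∈ N, x * y ∈ N := by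
    intro x h1 h2 h3 y hy
    suffices N ≤ N.comap (LinearMap.mulLeft k x) from this hy
    conv_lhs => rw [hN]
    rw [Submodule.span_le]
    rintro _ ⟨(i | ⟨g, j, hj⟩) | p, rfl⟩
    · exact h1 i
    · exact h3 g j (by have := Γ.dist_lt_val g; omega)
    · change x * Γ.crossFamily a p ∈ N
      rcases hcw p with ⟨i, hi⟩ | ⟨g, m, hm, hi⟩
      · rw [hi]; exact h2 i
      · rw [hi]; exact h3 g m hm
  refine Submodule.eq_top_of_adjoin_eq_top hgen N ?_ ?_
  · rw [← hs.idem.complete]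
    exact N.sum_mem fun i _ => he i
  · rintro x (⟨i, rfl⟩ | ⟨h, rfl⟩)
    · have hiw : ∀ h m, m < Γ.val h → e i * Γ.word a h (m + 1) ∈ N := by
        intro h m hm
        by_cases hil : i = Γ.edge h
        · subst hil; rw [hs.idem_mul_word]; exact hw _ _ hm
        · rw [hs.idem_mul_word_of_ne hil]; exact N.zero_mem
      refine hNspan _ (fun l => ?_) (fun h => ?_) fun h m hm => hiw h m (by omega)
      · by_cases hil : i = l
        · subst hil; rw [(hs.idem.idem i).eq]; exact he i
        · rw [hs.idem.ortho hil]; exact N.zero_mem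
      · have := hiw h (Γ.val h - 1) (by have := Γ.val_pos h; omega)
        rwa [Nat.sub_add_cancel (Γ.val_pos h)] at this
    · refine hNspan _ (fun l => ?_) (fun g => ?_) fun g m hm => ?_
      · by_cases hil : Γ.edge (Γ.next h) = l
        · subst hil; rw [hs.target, ← Γ.word_one a h]; exact hw h 0 (Γ.val_pos h)
        · rw [hs.mul_idem_of_ne hil]; exact N.zero_mem
      · rw [hs.mul_cycle]; exact N.zero_mem
      · by_cases hg : g = Γ.next h
        · subst hg; rw [← Γ.word_succ]; exact hw _ _ (by rwa [Γ.val_next] at hm)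
        · rw [hs.mul_word_of_ne hg]; exact N.zero_mem

end CutRibbonGraph

/-! ### Linear forms dual to paths, and the arrows acting on them -/

namespace CutRibbonGraph

variable {H E : Type} {Γ : CutRibbonGraph H E} {k : Type u} [Field k]
  {A : Type v} [Ring A] [Algebra k A] {e : E → A} {a : H → A}

section DualPath

variable (b : Module.Basis Γ.PathIndex k A)

open Classical in
/-- The linear form dual to the path of length `m` that starts at `g`. -/
def dualPath (g : H) : ℕ → Module.Dual k A
  | 0 => b.coord (.inl (Γ.edge g))
  | m + 1 => if hm : m < Γ.dist g then b.coord (.inr ⟨g, m, hm⟩) else 0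

variable {b} (hb : ∀ p, b p = Γ.pathFamily e a p)

include hb

open Classical in
theorem dualPath_idem (g : H) (m : ℕ) (i : E) :
    dualPath b g m (e i) = if m = 0 ∧ Γ.edge g = i then 1 else 0 := by
  have : e i = b (.inl i) := (hb (.inl i)).symm
  rw [this]
  cases m with
  | zero => simp [dualPath, Finsupp.single_apply, eq_comm]
  | succ m =>
    by_cases hm : m < Γ.dist g <;> simp [dualPath, hm]

variable [Fintype E] (hs : Γ.IsGentleSystem e a)

include hs

open Classical in
theorem dualPath_word {g : H} {m : ℕ} (hm : m ≤ Γ.dist g) (h : H) (j : ℕ) :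
    dualPath b g m (Γ.word a h (j + 1)) = if g = h ∧ m = j + 1 then 1 else 0 := by
  by_cases hj : j < Γ.dist h
  · have : Γ.word a h (j + 1) = b (.inr ⟨h, j, hj⟩) := (hb (.inr ⟨h, j, hj⟩)).symm
    rw [this]
    cases m with
    | zero => simp [dualPath]
    | succ m =>
      have hm' : m < Γ.dist g := by omega
      simp only [dualPath, dif_pos hm', Module.Basis.coord_apply, Module.Basis.repr_self,
        Finsupp.single_apply, Sum.inr.injEq, Nat.add_right_cancel_iff]
      refine if_congr ⟨fun h1 => ?_, fun h1 => ?_⟩ rfl rfl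
      · cases h1; exact ⟨rfl, rfl⟩
      · obtain ⟨rfl, rfl⟩ := h1; rfl
  · rw [hs.word_eq_zero (by omega), map_zero, if_neg]
    rintro ⟨rfl, rfl⟩
    omega

omit hs [Fintype E] in
theorem path_ext {N : Type*} [AddCommMonoid N] [Module k N] {f f' : A →ₗ[k] N}
    (h1 : ∀ i, f (e i) = f' (e i))
    (h2 : ∀ h j, f (Γ.word a h (j + 1)) = f' (Γ.word a h (j + 1))) : f = f' := by
  refine b.ext fun p => ?_
  rw [hb]
  rcases p with i | ⟨h, j⟩
  · exact h1 i
  · exact h2 h j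

/-- The only basis path that the last arrow prolongs to the given path is the path without this
arrow. In the bimodule, left multiplication by the last arrow therefore strips it. -/
theorem dualPath_mul_arrow {g : H} {m : ℕ} (hm : m < Γ.dist g) :
    dualPath b g (m + 1) ∘ₗ LinearMap.mulRight k (a (Γ.next^[m] g)) = dualPath b g m := by
  classical
  refine path_ext hb (fun i => ?_) fun h j => ?_
  · simp only [LinearMap.comp_apply, LinearMap.mulRight_apply, dualPath_idem hb]
    by_cases hi : i = Γ.edge (Γ.next^[m] g)
    · rw [hi, hs.source, ← Γ.word_one a, dualPath_word hb hs (by omega)]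
      refine if_congr ⟨fun h1 => ?_, fun h1 => ?_⟩ rfl rfl
      · obtain rfl : m = 0 := by omega
        simp
      · rw [h1.1]; simp
    · rw [hs.idem_mul_of_ne hi, map_zero, if_neg]
      rintro ⟨rfl, h1⟩
      exact hi h1.symm
  · simp only [LinearMap.comp_apply, LinearMap.mulRight_apply]
    by_cases hi : Γ.next^[m] g = Γ.next^[j + 1] h
    · rw [hi, ← Γ.word_succ', dualPath_word hb hs (by omega), dualPath_word hb hs (by omega)]
      simp
    · rw [hs.word_mul_of_ne hi, map_zero, dualPath_word hb hs (by omega), if_neg]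
      rintro ⟨rfl, rfl⟩
      exact hi rfl

/-- The mirror statement: right multiplication in the bimodule strips the first arrow. -/
theorem dualPath_arrow_mul {g : H} {m : ℕ} (hm : m < Γ.dist g) :
    dualPath b g (m + 1) ∘ₗ LinearMap.mulLeft k (a g) = dualPath b (Γ.next g) m := by
  classical
  have hd := Γ.dist_next g (by omega)
  refine path_ext hb (fun i => ?_) fun h j => ?_
  · simp only [LinearMap.comp_apply, LinearMap.mulLeft_apply, dualPath_idem hb]
    by_cases hi : Γ.edge (Γ.next g) = i
    · rw [← hi, hs.target, ← Γ.word_one a, dualPath_word hb hs (by omega)]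
      simp
    · rw [hs.mul_idem_of_ne hi, map_zero, if_neg]
      rintro ⟨rfl, h1⟩
      exact hi h1
  · simp only [LinearMap.comp_apply, LinearMap.mulLeft_apply]
    by_cases hi : h = Γ.next g
    · rw [hi, ← Γ.word_succ, dualPath_word hb hs (by omega), dualPath_word hb hs (by omega)]
      simp
    · rw [hs.mul_word_of_ne hi, map_zero, dualPath_word hb hs (by omega), if_neg]
      rintro ⟨rfl, rfl⟩
      exact hi rfl

/-- No path prolonged by `a h` can be the given one, which arrives at a half-edge other than `next
h`. -/
theorem dualPath_mul_arrow_eq_zero {g h : H} {m : ℕ} (hm : m ≤ Γ.dist g)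
    (hne : Γ.next^[m] g ≠ Γ.next h) :
    dualPath b g m ∘ₗ LinearMap.mulRight k (a h) = 0 := by
  classical
  refine path_ext hb (fun i => ?_) fun g' j => ?_
  · simp only [LinearMap.comp_apply, LinearMap.mulRight_apply, LinearMap.zero_apply]
    by_cases hi : i = Γ.edge h
    · rw [hi, hs.source, ← Γ.word_one a, dualPath_word hb hs hm, if_neg]
      rintro ⟨rfl, rfl⟩
      exact hne rfl
    · rw [hs.idem_mul_of_ne hi, map_zero]
  · simp only [LinearMap.comp_apply, LinearMap.mulRight_apply, LinearMap.zero_apply]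
    by_cases hi : h = Γ.next^[j + 1] g'
    · rw [hi, ← Γ.word_succ', dualPath_word hb hs hm, if_neg]
      rintro ⟨rfl, rfl⟩
      rw [hi] at hne
      exact hne (Function.iterate_succ_apply' _ _ _)
    · rw [hs.word_mul_of_ne hi, map_zero]

theorem dualPath_arrow_mul_eq_zero {g h : H} {m : ℕ} (hm : m ≤ Γ.dist g) (hne : g ≠ h) :
    dualPath b g m ∘ₗ LinearMap.mulLeft k (a h) = 0 := by
  classical
  refine path_ext hb (fun i => ?_) fun g' j => ?_
  · simp only [LinearMap.comp_apply, LinearMap.mulLeft_apply, LinearMap.zero_apply]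
    by_cases hi : Γ.edge (Γ.next h) = i
    · rw [← hi, hs.target, ← Γ.word_one a, dualPath_word hb hs hm, if_neg]
      exact fun h1 => hne h1.1
    · rw [hs.mul_idem_of_ne hi, map_zero]
  · simp only [LinearMap.comp_apply, LinearMap.mulLeft_apply, LinearMap.zero_apply]
    by_cases hi : g' = Γ.next h
    · rw [hi, ← Γ.word_succ, dualPath_word hb hs hm, if_neg]
      exact fun h1 => hne h1.1
    · rw [hs.mul_word_of_ne hi, map_zero]

/-- A dual path runs backwards: as an element of the bimodule it starts at the edge where the path
ends, and by `dualPath_idem_mul` it ends where the path starts. -/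
theorem dualPath_mul_idem {g : H} {m : ℕ} (hm : m ≤ Γ.dist g) :
    dualPath b g m ∘ₗ LinearMap.mulRight k (e (Γ.edge (Γ.next^[m] g))) = dualPath b g m := by
  classical
  refine path_ext hb (fun i => ?_) fun h j => ?_
  · simp only [LinearMap.comp_apply, LinearMap.mulRight_apply]
    by_cases hi : i = Γ.edge (Γ.next^[m] g)
    · rw [← hi, (hs.idem.idem i).eq]
    · rw [hs.idem.ortho hi, map_zero, dualPath_idem hb, if_neg]
      rintro ⟨rfl, h1⟩
      exact hi h1.symm
  · simp only [LinearMap.comp_apply, LinearMap.mulRight_apply]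
    by_cases hi : Γ.edge (Γ.next^[j + 1] h) = Γ.edge (Γ.next^[m] g)
    · rw [← hi, hs.word_mul_idem]
    · rw [hs.word_mul_idem_of_ne hi, map_zero, dualPath_word hb hs hm, if_neg]
      rintro ⟨rfl, rfl⟩
      exact hi rfl

theorem dualPath_idem_mul {g : H} {m : ℕ} (hm : m ≤ Γ.dist g) :
    dualPath b g m ∘ₗ LinearMap.mulLeft k (e (Γ.edge g)) = dualPath b g m := by
  classical
  refine path_ext hb (fun i => ?_) fun h j => ?_
  · simp only [LinearMap.comp_apply, LinearMap.mulLeft_apply]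
    by_cases hi : Γ.edge g = i
    · rw [← hi, (hs.idem.idem _).eq]
    · rw [hs.idem.ortho hi, map_zero, dualPath_idem hb, if_neg]
      exact fun h1 => hi h1.2
  · simp only [LinearMap.comp_apply, LinearMap.mulLeft_apply]
    by_cases hi : Γ.edge g = Γ.edge h
    · rw [hi, hs.idem_mul_word]
    · rw [hs.idem_mul_word_of_ne hi, map_zero, dualPath_word hb hs hm, if_neg]
      rintro ⟨rfl, rfl⟩
      exact hi rfl

end DualPath

/-! ### The Brauer system in the trivial extension -/

section TrivialExtension

/-- The element of the trivial extension given by a linear form. -/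
def inrDual (f : Module.Dual k A) : TrivialExtension k A :=
  TrivSqZeroExt.inr (show DualBimodule k A from f)

theorem inl_mul_inrDual (x : A) (f : Module.Dual k A) :
    (TrivSqZeroExt.inl x : TrivialExtension k A) * inrDual f =
      inrDual (f ∘ₗ LinearMap.mulRight k x) :=
  TrivSqZeroExt.inl_mul_inr x _

theorem inrDual_mul_inl (x : A) (f : Module.Dual k A) :
    inrDual f * (TrivSqZeroExt.inl x : TrivialExtension k A) =
      inrDual (f ∘ₗ LinearMap.mulLeft k x) :=
  TrivSqZeroExt.inr_mul_inl x _

theorem inrDual_mul_inrDual (f g : Module.Dual k A) : inrDual f * inrDual g = 0 :=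
  TrivSqZeroExt.inr_mul_inr A _ _

theorem inrDual_zero : inrDual (0 : Module.Dual k A) = 0 := TrivSqZeroExt.inr_zero A

variable (b : Module.Basis Γ.PathIndex k A)

open Classical in
/-- The arrows in the trivial extension: an arrow across a cut is the linear form dual to the
longest path around the vertex that does not cross the cut. -/
def extArrow (a : H → A) (h : H) : TrivialExtension k A :=
  if Γ.dist h = 0 then inrDual (dualPath b (Γ.next h) (Γ.dist (Γ.next h)))
  else TrivSqZeroExt.inl (a h)

variable {b}

theorem extArrow_of_eq {h : H} (h0 : Γ.dist h = 0) :
    extArrow b a h = inrDual (dualPath b (Γ.next h) (Γ.dist (Γ.next h))) := if_pos h0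

theorem extArrow_of_ne {h : H} (h0 : Γ.dist h ≠ 0) :
    extArrow b a h = TrivSqZeroExt.inl (a h) := if_neg h0

theorem word_extArrow_of_le {h : H} {m : ℕ} (hm : m ≤ Γ.dist h) :
    Γ.word (extArrow b a) h m = TrivSqZeroExt.inl (Γ.word a h m) := by
  induction m generalizing h with
  | zero => rfl
  | succ m ih =>
    have h0 : Γ.dist h ≠ 0 := by omega
    have := Γ.dist_next h h0
    rw [word_succ, word_succ, ih (by omega), extArrow_of_ne h0, ← TrivSqZeroExt.inl_mul]

variable [Fintype E] (hb : ∀ p, b p = Γ.pathFamily e a p) (hs : Γ.IsGentleSystem e a)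

include hb hs

/-- The word that stops just after the cut. Its last letter is the dual of the longest path, and
each arrow in front strips the last arrow of what is left. -/
theorem word_extArrow_dist_succ (h : H) :
    Γ.word (extArrow b a) h (Γ.dist h + 1) =
      inrDual (dualPath b (Γ.next^[Γ.dist h + 1] h) (Γ.val h - (Γ.dist h + 1))) := by
  induction hd : Γ.dist h generalizing h with
  | zero =>
    rw [zero_add, word_one, extArrow_of_eq hd, Γ.val_eq hd]
    simp
  | succ d ih =>
    have h1 := Γ.dist_next h (by omega)
    have hlt := Γ.dist_lt_val h
    rw [word_succ, ih (Γ.next h) (by omega), extArrow_of_ne (by omega), inl_mul_inrDual, Γ.val_next]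
    have hf := Γ.dist_iterate_of_lt (h := h) (n := d + 1 + 1) (by omega) (by omega)
    rw [← Function.iterate_succ_apply, Nat.succ_eq_add_one]
    have h2 : Γ.val h - (d + 1) = Γ.val h - (d + 1 + 1) + 1 := by omega
    -- The arrow at `h` is the last arrow of the path that remains to be stripped.
    have h3 : Γ.next^[Γ.val h - (d + 1 + 1)] (Γ.next^[d + 1 + 1] h) = h := by
      rw [← Function.iterate_add_apply, Nat.sub_add_cancel (by omega), Γ.iterate_val]
    have key := dualPath_mul_arrow hb hs (g := Γ.next^[d + 1 + 1] h)
      (m := Γ.val h - (d + 1 + 1)) (by omega)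
    rw [h3] at key
    rw [h2, key]

/-- Past the cut, each further arrow on the right strips the first arrow of the dual path, so the
form stays dual to the complement of the word. -/
theorem word_extArrow_of_lt {h : H} {n : ℕ} (h1 : Γ.dist h < n) (h2 : n ≤ Γ.val h) :
    Γ.word (extArrow b a) h n = inrDual (dualPath b (Γ.next^[n] h) (Γ.val h - n)) := by
  obtain ⟨j, rfl⟩ := Nat.exists_eq_add_of_le (Nat.succ_le_of_lt h1)
  rw [Nat.succ_eq_add_one] at *
  induction j with
  | zero => exact word_extArrow_dist_succ hb hs h
  | succ j ih =>
    have hd := Γ.dist_iterate_of_lt (h := h) (n := Γ.dist h + 1 + j) (by omega) (by omega)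
    rw [← add_assoc, word_succ', ih (by omega) (by omega), extArrow_of_ne (by omega),
      inrDual_mul_inl, Function.iterate_succ_apply']
    have h3 : Γ.val h - (Γ.dist h + 1 + j) = Γ.val h - (Γ.dist h + 1 + j + 1) + 1 := by omega
    rw [h3, dualPath_arrow_mul hb hs (by omega)]

theorem word_extArrow_val (h : H) :
    Γ.word (extArrow b a) h (Γ.val h) = inrDual (b.coord (.inl (Γ.edge h))) := by
  rw [word_extArrow_of_lt hb hs (Γ.dist_lt_val h) le_rfl, Γ.iterate_val, Nat.sub_self]
  rfl

/-- Non-consecutive products vanish by the relations of `A`, by stripping a wrong arrow, or by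
`D(A)² = 0`. The cycles at both ends of an edge are the form dual to its trivial path. -/
theorem isBrauerSystem_extArrow :
    Γ.IsBrauerSystem (fun i => (TrivSqZeroExt.inl (e i) : TrivialExtension k A))
      (extArrow b a) where
  idem := hs.idem.map (TrivSqZeroExt.inlHom A (DualBimodule k A))
  source h := by
    by_cases h0 : Γ.dist h = 0
    · have := dualPath_mul_idem hb hs (g := Γ.next h) le_rfl
      rw [Γ.iterate_dist_next h h0] at this
      rw [extArrow_of_eq h0, inl_mul_inrDual, this]
    · rw [extArrow_of_ne h0, ← TrivSqZeroExt.inl_mul, hs.source]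
  target h := by
    by_cases h0 : Γ.dist h = 0
    · rw [extArrow_of_eq h0, inrDual_mul_inl, dualPath_idem_mul hb hs le_rfl]
    · rw [extArrow_of_ne h0, ← TrivSqZeroExt.inl_mul, hs.target]
  zero h := by
    by_cases h0 : Γ.dist h = 0 <;> by_cases h1 : Γ.dist (Γ.opp (Γ.next h)) = 0
    · rw [extArrow_of_eq h0, extArrow_of_eq h1, inrDual_mul_inrDual]
    · rw [extArrow_of_eq h0, extArrow_of_ne h1, inrDual_mul_inl,
        dualPath_arrow_mul_eq_zero hb hs le_rfl (Γ.opp_ne _).symm, inrDual_zero]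
    · rw [extArrow_of_ne h0, extArrow_of_eq h1, inl_mul_inrDual,
        dualPath_mul_arrow_eq_zero hb hs le_rfl, inrDual_zero]
      rw [Γ.iterate_dist_next _ h1]
      exact Γ.opp_ne _
    · rw [extArrow_of_ne h0, extArrow_of_ne h1, ← TrivSqZeroExt.inl_mul, hs.zero,
        TrivSqZeroExt.inl_zero]
  cycle h := by
    rw [word_extArrow_val hb hs, word_extArrow_val hb hs, Γ.edge_opp]

end TrivialExtension

/-- The map sending the basis back to the family is a two-sided inverse, so independence of the
spanning family need not be known beforehand. -/
theorem _root_.LinearMap.bijective_of_span_of_basis {ι B C : Type*} [AddCommGroup B] [Module k B]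
    [AddCommGroup C] [Module k C] (f : B →ₗ[k] C) (v : ι → B)
    (hv : Submodule.span k (Set.range v) = ⊤) (c : Module.Basis ι k C) (hf : ∀ i, f (v i) = c i) :
    Function.Bijective f := by
  have hg : ∀ x, c.constr k v (f x) = x := by
    intro x
    have : (c.constr k v).comp f = LinearMap.id :=
      LinearMap.ext_on_range hv fun i => by simp [hf]
    exact congrArg (fun φ => φ x) this
  refine ⟨Function.LeftInverse.injective hg, fun y => ⟨c.constr k v y, ?_⟩⟩
  have : f.comp (c.constr k v) = LinearMap.id := c.ext fun i => by simp [hf]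
  exact congrArg (fun φ => φ y) this

open Classical in
/-- The basis of the trivial extension given by a basis and its dual basis. -/
def extBasis [Finite H] [Finite E] (b : Module.Basis Γ.PathIndex k A) :
    Module.Basis (Γ.PathIndex ⊕ Γ.PathIndex) k (TrivialExtension k A) :=
  show Module.Basis (Γ.PathIndex ⊕ Γ.PathIndex) k (A × Module.Dual k A) from b.prod b.dualBasis

theorem extBasis_inl [Finite H] [Finite E] (b : Module.Basis Γ.PathIndex k A) (p : Γ.PathIndex) :
    extBasis b (.inl p) = TrivSqZeroExt.inl (b p) := by
  classical
  exact Prod.ext (b.prod_apply_inl_fst b.dualBasis p) (b.prod_apply_inl_snd b.dualBasis p)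

theorem extBasis_inr [Finite H] [Finite E] (b : Module.Basis Γ.PathIndex k A) (p : Γ.PathIndex) :
    extBasis b (.inr p) = inrDual (b.coord p) := by
  classical
  exact Prod.ext (b.prod_apply_inr_fst b.dualBasis p)
    ((b.prod_apply_inr_snd b.dualBasis p).trans (congrFun b.coe_dualBasis p))

/-- The trivial extension of an algebra with the universal gentle system is the algebra with the
universal Brauer system. -/
theorem nonempty_algEquiv [Finite H] [Fintype E] {B : Type*} [Ring B] [Algebra k B]
    {e' : E → B} {a' : H → B} (hs : Γ.IsGentleSystem e a)
    (hgen : Algebra.adjoin k (Set.range e ∪ Set.range a) = ⊤)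
    (hrep : ∃ f : A →ₐ[k] Module.End k (Γ.PathIndex →₀ k),
      (∀ i, f (e i) = Γ.actIdem k i) ∧ ∀ h, f (a h) = Γ.actArrow k h)
    (hs' : Γ.IsBrauerSystem e' a')
    (hgen' : Algebra.adjoin k (Set.range e' ∪ Set.range a') = ⊤)
    (hlift : ∀ (e₁ : E → TrivialExtension k A) (a₁ : H → TrivialExtension k A),
      Γ.IsBrauerSystem e₁ a₁ → ∃ f : B →ₐ[k] TrivialExtension k A,
        (∀ i, f (e' i) = e₁ i) ∧ ∀ h, f (a' h) = a₁ h) :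
    Nonempty (TrivialExtension k A ≃ₐ[k] B) := by
  obtain ⟨f, hfe, hfa⟩ := hrep
  let b : Module.Basis Γ.PathIndex k A :=
    Module.Basis.mk (linearIndependent_pathFamily f hfe hfa) (hs.span_eq_top hgen).ge
  have hb : ∀ p, b p = Γ.pathFamily e a p := fun p => Module.Basis.mk_apply _ _ p
  obtain ⟨φ, hφe, hφa⟩ := hlift _ _ (isBrauerSystem_extArrow hb hs)
  have hφw : ∀ h m, φ (Γ.word a' h m) = Γ.word (extArrow b a) h m := by
    intro h m
    rw [map_word]
    simp only [hφa]
  refine ⟨(AlgEquiv.ofBijective φ ?_).symm⟩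
  refine φ.toLinearMap.bijective_of_span_of_basis _ (hs'.span_eq_top hgen') (extBasis b) ?_
  rintro (p | p)
  · rw [extBasis_inl, hb]
    rcases p with i | ⟨h, j, hj⟩
    · exact hφe i
    · exact (hφw h (j + 1)).trans (word_extArrow_of_le (by omega))
  · rw [extBasis_inr]
    rcases p with i | ⟨g, j, hj⟩
    -- The full cycle was taken at a chosen half-edge of `i`; its image depends only on the edge.
    · refine (hφw _ _).trans ((word_extArrow_val hb hs _).trans ?_)
      rw [Function.surjInv_eq Γ.edge_surjective]
    · have hlt := Γ.dist_lt_val g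
      refine (hφw _ _).trans ?_
      have hd := Γ.dist_iterate (h := g) (j := j + 1) (by omega)
      -- This word is longer than its distance to the cut and ends at `g`, so its image is dual to
      -- the path of length `j + 1` from `g`.
      rw [word_extArrow_of_lt hb hs (by simp only; omega) (by rw [Γ.val_iterate]; omega),
        ← Function.iterate_add_apply, Γ.val_iterate]
      simp only
      rw [Nat.sub_add_cancel (by omega), Γ.iterate_val,
        show Γ.val g - (Γ.val g - (j + 1)) = j + 1 by omega]
      simp [dualPath, hj]

end CutRibbonGraph

/-! ### Universal properties of path algebras and their quotients -/

namespace PathAlgebra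

variable {k : Type u} {V : Type v} [Field k] [Quiver.{v} V] {R : Type w} [Ring R]

/-- The value of a path, given the values of the trivial paths and of the arrows. -/
def pathVal (e : V → R) (arr : ∀ {i j : V}, (i ⟶ j) → R) {i : V} :
    ∀ {j : V}, Quiver.Path i j → R
  | _, .nil => e i
  | _, .cons p f => pathVal e arr p * arr f

variable [Fintype V] {e : V → R} {arr : ∀ {i j : V}, (i ⟶ j) → R}
  (he : CompleteOrthogonalIdempotents e)
  (hl : ∀ {i j : V} (f : i ⟶ j), e i * arr f = arr f)
  (hr : ∀ {i j : V} (f : i ⟶ j), arr f * e j = arr f)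

include he in
theorem idem_mul_pathVal {i j : V} (p : Quiver.Path i j) :
    e i * pathVal e arr p = pathVal e arr p := by
  induction p with
  | nil => exact (he.idem i).eq
  | cons p f ih => rw [pathVal, ← mul_assoc, ih]

include he hr in
theorem pathVal_mul_idem {i j : V} (p : Quiver.Path i j) :
    pathVal e arr p * e j = pathVal e arr p := by
  cases p with
  | nil => exact (he.idem i).eq
  | cons p f => rw [pathVal, mul_assoc, hr]

include he hr in
theorem pathVal_comp {i j l : V} (p : Quiver.Path i j) (q : Quiver.Path j l) :
    pathVal e arr (p.comp q) = pathVal e arr p * pathVal e arr q := by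
  induction q with
  | nil => rw [Quiver.Path.comp_nil, pathVal, pathVal_mul_idem he hr]
  | cons q f ih => rw [Quiver.Path.comp_cons, pathVal, pathVal, ih, mul_assoc]

variable [Algebra k R]

variable (k) in
/-- The algebra homomorphism from the path algebra with given values on the trivial paths and the
arrows. -/
def liftAlgHom : PathAlgebra k V →ₐ[k] R :=
  AlgHom.ofLinearMap (lift fun p => pathVal e arr p.2.2)
    (by
      rw [one_def, map_sum, ← he.complete]
      exact Finset.sum_congr rfl fun i _ => lift_ofPath _ _)
    (by
      set φ : PathAlgebra k V →ₗ[k] R := lift fun p => pathVal e arr p.2.2 with hφ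
      intro x y
      -- Multiplicativity is an equality of bilinear maps, so it is enough to compare them on pairs
      -- of paths.
      have key : (mulLin k V).compr₂ φ = (LinearMap.mul k R).compl₁₂ φ φ := by
        refine lin_ext fun i j p => lin_ext fun i' j' q => ?_
        change φ (ofPath k p * ofPath k q) = φ (ofPath k p) * φ (ofPath k q)
        rw [hφ, lift_ofPath, lift_ofPath]
        by_cases h : j = i'
        · subst h
          rw [ofPath_mul_ofPath, lift_ofPath, pathVal_comp he hr]
        · rw [ofPath_mul_ofPath_of_ne _ _ h, map_zero, ← pathVal_mul_idem he hr p,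
            ← idem_mul_pathVal he q, mul_assoc, ← mul_assoc (e j), he.ortho h, zero_mul, mul_zero]
      exact congrArg (fun ψ => ψ x y) key)

theorem liftAlgHom_nil (i : V) :
    liftAlgHom k he hr (ofPath k (Quiver.Path.nil : Quiver.Path i i)) = e i :=
  lift_ofPath _ _

include hl in
theorem liftAlgHom_ofArrow {i j : V} (f : i ⟶ j) :
    liftAlgHom k he hr (ofArrow k f) = arr f :=
  (lift_ofPath _ _).trans (hl f)

variable (k V) in
omit he in
theorem completeOrthogonalIdempotents_nil :
    CompleteOrthogonalIdempotents
      fun i : V => ofPath k (Quiver.Path.nil : Quiver.Path i i) :=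
  CompleteOrthogonalIdempotents.iff_ortho_complete.2
    ⟨fun _ _ hij => ofPath_mul_ofPath_of_ne _ _ hij, rfl⟩

omit [Fintype V] in
theorem nil_mul_ofArrow {i j : V} (f : i ⟶ j) :
    ofPath k (Quiver.Path.nil : Quiver.Path i i) * ofArrow k f = ofArrow k f := by
  rw [ofArrow, ofPath_mul_ofPath, Quiver.Path.nil_comp]

omit [Fintype V] in
theorem ofArrow_mul_nil {i j : V} (f : i ⟶ j) :
    ofArrow k f * ofPath k (Quiver.Path.nil : Quiver.Path j j) = ofArrow k f := by
  rw [ofArrow, ofPath_mul_ofPath, Quiver.Path.comp_nil]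

/-- A subalgebra that contains the trivial paths and the arrows is everything. -/
theorem subalgebra_eq_top (S : Subalgebra k (PathAlgebra k V))
    (h1 : ∀ i : V, ofPath k (Quiver.Path.nil : Quiver.Path i i) ∈ S)
    (h2 : ∀ {i j : V} (f : i ⟶ j), ofArrow k f ∈ S) : S = ⊤ := by
  have hp : ∀ {i j : V} (p : Quiver.Path i j), ofPath k p ∈ S := by
    intro i j p
    induction p with
    | nil => exact h1 i
    | cons p f ih =>
      have : ofPath k (p.cons f) = ofPath k p * ofArrow k f := by
        rw [ofArrow, ofPath_mul_ofPath]; rfl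
      rw [this]
      exact S.mul_mem ih (h2 f)
  rw [eq_top_iff]
  rintro x -
  change x ∈ S.toSubmodule
  induction x using Finsupp.induction_linear with
  | zero => exact S.toSubmodule.zero_mem
  | add f g hf hg => exact S.toSubmodule.add_mem hf hg
  | single p c =>
    have : (Finsupp.single p c : (Σ a b : V, Quiver.Path a b) →₀ k) =
        c • Finsupp.single p (1 : k) := by simp
    rw [this]
    exact S.toSubmodule.smul_mem c (hp p.2.2)

end PathAlgebra

namespace BoundQuiverAlgebra

variable {k : Type u} {V : Type v} [Field k] [Quiver.{v} V] [Fintype V]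

/-- The projection from the path algebra. -/
def proj (ρ : Set (PathAlgebra k V)) : PathAlgebra k V →ₐ[k] BoundQuiverAlgebra k V ρ :=
  RingCon.mkₐ k (TwoSidedIdeal.span ρ).ringCon

variable {ρ : Set (PathAlgebra k V)}

theorem proj_surjective : Function.Surjective (proj ρ) := Quotient.mk''_surjective

theorem proj_eq_zero {x : PathAlgebra k V} (hx : x ∈ ρ) : proj ρ x = 0 :=
  (RingCon.eq _).2 (TwoSidedIdeal.subset_span hx)

theorem exists_lift {R : Type w} [Ring R] [Algebra k R] (f : PathAlgebra k V →ₐ[k] R)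
    (hf : ∀ x ∈ ρ, f x = 0) :
    ∃ g : BoundQuiverAlgebra k V ρ →ₐ[k] R, ∀ x, g (proj ρ x) = f x := by
  have hle : TwoSidedIdeal.span ρ ≤ TwoSidedIdeal.ker f.toRingHom :=
    TwoSidedIdeal.span_le.2 fun x hx => (TwoSidedIdeal.mem_ker _).2 (hf x hx)
  exact ⟨RingCon.liftₐ _ f (TwoSidedIdeal.ringCon_le_iff.1 hle), fun x => rfl⟩

/-- A subalgebra that contains the trivial paths and the arrows is everything. -/
theorem subalgebra_eq_top (S : Subalgebra k (BoundQuiverAlgebra k V ρ))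
    (h1 : ∀ i : V, proj ρ (PathAlgebra.ofPath k (Quiver.Path.nil : Quiver.Path i i)) ∈ S)
    (h2 : ∀ {i j : V} (f : i ⟶ j), proj ρ (PathAlgebra.ofArrow k f) ∈ S) : S = ⊤ := by
  have := PathAlgebra.subalgebra_eq_top (S.comap (proj ρ)) h1 h2
  rw [eq_top_iff]
  rintro x -
  obtain ⟨y, rfl⟩ := proj_surjective x
  have hy : y ∈ S.comap (proj ρ) := by rw [this]; trivial
  exact hy

end BoundQuiverAlgebra

/-! ### The Brauer graph algebra as the universal Brauer system -/

namespace BrauerGraph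

variable {G : BrauerGraph}

theorem edge_eq_iff (g h : G.HalfEdge) : edge g = edge h ↔ g = h ∨ g = G.opp h := by
  have hsq : G.opp * G.opp = 1 := Equiv.ext G.opp_opp
  constructor
  · intro he
    obtain ⟨i, hi⟩ : G.opp.SameCycle g h := Quotient.exact he
    rcases Int.even_or_odd' i with ⟨c, rfl | rfl⟩
    · left
      rwa [zpow_mul, zpow_two, hsq, one_zpow] at hi
    · right
      rw [zpow_add, zpow_mul, zpow_two, hsq, one_zpow, zpow_one, one_mul] at hi
      rw [← hi, G.opp_opp]
  · rintro (rfl | rfl)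
    · rfl
    · exact Quotient.sound (⟨1, by rw [zpow_one, G.opp_opp]⟩ : G.opp.SameCycle _ _)

/-- A Brauer graph together with a cut at each vertex. -/
def cutRibbonGraph (G : BrauerGraph) (dist : G.HalfEdge → ℕ)
    (dist_next : ∀ h, dist h ≠ 0 → dist (G.next h) + 1 = dist h)
    (iterate_dist_next : ∀ h, dist h = 0 → G.next^[dist (G.next h)] (G.next h) = h) :
    CutRibbonGraph G.HalfEdge G.Edge where
  opp := G.opp
  opp_ne := G.opp_ne
  next := G.next
  edge := edge
  edge_surjective := Quotient.mk_surjective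
  edge_eq_iff := edge_eq_iff
  dist := dist
  dist_next := dist_next
  iterate_dist_next := iterate_dist_next

theorem carriesArrow_opp {h : G.HalfEdge} (hh : ¬ CarriesArrow h) : CarriesArrow (G.opp h) := by
  intro ht
  exact absurd (fun _ => ht) hh

theorem next_eq_of_not_carriesArrow {h : G.HalfEdge} (hh : ¬ CarriesArrow h) : G.next h = h := by
  by_contra hn
  exact hh fun ht => absurd ht.1 hn

theorem Arrow.iterate_next_val (a : G.Arrow) (i : ℕ) :
    (Arrow.next^[i] a).1 = G.next^[i] a.1 := by
  induction i with
  | zero => rfl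
  | succ i ih => rw [Function.iterate_succ_apply', Function.iterate_succ_apply', ← ih]; rfl

variable (k : Type u) [Field k]

/-- The trivial path at an edge, as an element of the Brauer graph algebra. -/
def idemElt (i : G.Edge) : G.algebra k :=
  BoundQuiverAlgebra.proj _ (PathAlgebra.ofPath k (Quiver.Path.nil : Quiver.Path i i))

open Classical in
/-- The arrow at a half-edge, as an element of the Brauer graph algebra. If there is no arrow, it
is replaced by the cycle at the other end of the edge. -/
def halfEdgeElt (h : G.HalfEdge) : G.algebra k :=
  if hh : CarriesArrow h then BoundQuiverAlgebra.proj _ (arrowElt k ⟨h, hh⟩)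
  else BoundQuiverAlgebra.proj _ (cycle k ⟨G.opp h, carriesArrow_opp hh⟩)

theorem halfEdgeElt_of_carriesArrow (a : G.Arrow) :
    halfEdgeElt k a.1 = BoundQuiverAlgebra.proj {x | Relation G k x} (arrowElt k a) :=
  dif_pos a.2

theorem map_cycle_eq_word (R : Type w) [Ring R] [Algebra k R] (f : PathAlgebra k G.Edge →ₐ[k] R)
    (Γ : CutRibbonGraph G.HalfEdge G.Edge) (hΓ : Γ.next = G.next) (a' : G.HalfEdge → R)
    (hf : ∀ a : G.Arrow, f (arrowElt k a) = a' a.1) (a : G.Arrow) :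
    f (cycle k a) = Γ.word a' a.1 (Γ.val a.1) := by
  rw [cycle, map_list_prod, CutRibbonGraph.word, CutRibbonGraph.val, hΓ, List.map_map]
  congr 1
  refine List.map_congr_left fun i _ => ?_
  rw [Function.comp_apply, hf, Arrow.iterate_next_val]

variable {dist : G.HalfEdge → ℕ}
  {hd : ∀ h, dist h ≠ 0 → dist (G.next h) + 1 = dist h}
  {hd' : ∀ h, dist h = 0 → G.next^[dist (G.next h)] (G.next h) = h}

local notation "Γ" => G.cutRibbonGraph dist hd hd'

theorem proj_cycle (a : G.Arrow) :
    BoundQuiverAlgebra.proj {x | Relation G k x} (cycle k a) =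
      CutRibbonGraph.word Γ (halfEdgeElt k) a.1 (CutRibbonGraph.val Γ a.1) :=
  map_cycle_eq_word k _ _ Γ rfl _ (fun b => (halfEdgeElt_of_carriesArrow k b).symm) a

theorem halfEdgeElt_of_not_carriesArrow {h : G.HalfEdge} (hh : ¬ CarriesArrow h) :
    halfEdgeElt k h = CutRibbonGraph.word Γ (halfEdgeElt k) (G.opp h)
      (CutRibbonGraph.val Γ (G.opp h)) := by
  rw [halfEdgeElt, dif_neg hh, proj_cycle k (hd := hd) (hd' := hd')]

omit [Field k] in
theorem val_of_not_carriesArrow {h : G.HalfEdge} (hh : ¬ CarriesArrow h) :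
    CutRibbonGraph.val Γ h = 1 :=
  Function.minimalPeriod_eq_one_iff_isFixedPt.2 (next_eq_of_not_carriesArrow hh)

theorem idemElt_mul_of_carriesArrow {h : G.HalfEdge} (hh : CarriesArrow h) :
    idemElt k (edge h) * halfEdgeElt k h = halfEdgeElt k h := by
  rw [halfEdgeElt_of_carriesArrow k ⟨h, hh⟩, idemElt, ← map_mul]
  exact congrArg _ (PathAlgebra.nil_mul_ofArrow _)

theorem mul_idemElt_of_carriesArrow {h : G.HalfEdge} (hh : CarriesArrow h) :
    halfEdgeElt k h * idemElt k (edge (G.next h)) = halfEdgeElt k h := by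
  rw [halfEdgeElt_of_carriesArrow k ⟨h, hh⟩, idemElt, ← map_mul]
  exact congrArg _ (PathAlgebra.ofArrow_mul_nil _)

variable (hG : ∀ h : G.HalfEdge, multAt h = 1)

include hG

theorem cycle_eq_of_carriesArrow {h : G.HalfEdge} (hh : CarriesArrow h)
    (ho : CarriesArrow (G.opp h)) :
    CutRibbonGraph.word Γ (halfEdgeElt k) h (CutRibbonGraph.val Γ h) =
      CutRibbonGraph.word Γ (halfEdgeElt k) (G.opp h) (CutRibbonGraph.val Γ (G.opp h)) := by
  have h1 := BoundQuiverAlgebra.proj_eq_zero (ρ := {x | Relation G k x})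
    (Relation.commute (⟨h, hh⟩ : G.Arrow) ⟨G.opp h, ho⟩ rfl)
  rw [map_sub, sub_eq_zero] at h1
  simp only [hG, pow_one] at h1
  rwa [proj_cycle k (hd := hd) (hd' := hd'), proj_cycle k (hd := hd) (hd' := hd')] at h1

theorem cycle_mul_of_not_carriesArrow {h : G.HalfEdge} (hh : CarriesArrow h)
    (ho : ¬ CarriesArrow (G.opp h)) :
    CutRibbonGraph.word Γ (halfEdgeElt k) h (CutRibbonGraph.val Γ h) * halfEdgeElt k h = 0 := by
  have h1 := BoundQuiverAlgebra.proj_eq_zero (ρ := {x | Relation G k x})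
    (Relation.leaf (⟨h, hh⟩ : G.Arrow) ho)
  simp only [hG, pow_one] at h1
  rwa [map_mul, proj_cycle k (hd := hd) (hd' := hd'), ← halfEdgeElt_of_carriesArrow] at h1

omit hG in
theorem mul_eq_zero_of_carriesArrow {h : G.HalfEdge} (hh : CarriesArrow h)
    (ho : CarriesArrow (G.opp (G.next h))) :
    halfEdgeElt k h * halfEdgeElt k (G.opp (G.next h)) = 0 := by
  have h1 := BoundQuiverAlgebra.proj_eq_zero (ρ := {x | Relation G k x})
    (Relation.zero (⟨h, hh⟩ : G.Arrow) ⟨G.opp (G.next h), ho⟩ rfl)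
  rwa [map_mul, ← halfEdgeElt_of_carriesArrow, ← halfEdgeElt_of_carriesArrow] at h1

/-- If the other end has no arrow, this is the leaf relation. Otherwise the cycle may be replaced by
the one at the other end, whose last arrow is not followed by the arrow at `h`. -/
theorem cycle_mul_eq_zero {h : G.HalfEdge} (hh : CarriesArrow h) :
    CutRibbonGraph.word Γ (halfEdgeElt k) h (CutRibbonGraph.val Γ h) * halfEdgeElt k h = 0 := by
  by_cases ho : CarriesArrow (G.opp h)
  · rw [cycle_eq_of_carriesArrow k hG hh ho]
    obtain ⟨m, hm⟩ := Nat.exists_eq_succ_of_ne_zero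
      (CutRibbonGraph.val_pos Γ (G.opp h)).ne'
    have hy : G.next (G.next^[m] (G.opp h)) = G.opp h := by
      have := CutRibbonGraph.iterate_val Γ (G.opp h)
      rw [hm, Function.iterate_succ_apply'] at this
      exact this
    have hc : CarriesArrow (G.next^[m] (G.opp h)) :=
      Arrow.iterate_next_val ⟨G.opp h, ho⟩ m ▸ (Arrow.next^[m] ⟨G.opp h, ho⟩).2
    have h1 : G.opp (G.next (G.next^[m] (G.opp h))) = h := by rw [hy, G.opp_opp]
    have h2 := mul_eq_zero_of_carriesArrow k hc (by rw [h1]; exact hh)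
    rw [h1] at h2
    rw [hm, Nat.succ_eq_add_one, CutRibbonGraph.word_succ', mul_assoc]
    refine Eq.trans (congrArg _ h2) (mul_zero _)
  · exact cycle_mul_of_not_carriesArrow k hG hh ho

/-- What needs proof beyond the defining relations is that the cycle put in place of a missing arrow
behaves like an arrow. -/
theorem isBrauerSystem : CutRibbonGraph.IsBrauerSystem Γ (idemElt k) (halfEdgeElt k) where
  idem := (PathAlgebra.completeOrthogonalIdempotents_nil k G.Edge).map
    (BoundQuiverAlgebra.proj {x | Relation G k x}).toRingHom
  source h := by
    by_cases hh : CarriesArrow h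
    · exact idemElt_mul_of_carriesArrow k hh
    · rw [halfEdgeElt_of_not_carriesArrow k (hd := hd) (hd' := hd') hh]
      obtain ⟨m, hm⟩ := Nat.exists_eq_succ_of_ne_zero
        (CutRibbonGraph.val_pos Γ (G.opp h)).ne'
      have he : CutRibbonGraph.edge Γ h = edge (G.opp h) := (CutRibbonGraph.edge_opp Γ h).symm
      rw [hm, Nat.succ_eq_add_one, CutRibbonGraph.word_succ, ← mul_assoc, he,
        idemElt_mul_of_carriesArrow k (carriesArrow_opp hh)]
  target h := by
    by_cases hh : CarriesArrow h
    · exact mul_idemElt_of_carriesArrow k hh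
    · have hn : CutRibbonGraph.next Γ h = h := next_eq_of_not_carriesArrow hh
      rw [halfEdgeElt_of_not_carriesArrow k (hd := hd) (hd' := hd') hh]
      obtain ⟨m, hm⟩ := Nat.exists_eq_succ_of_ne_zero
        (CutRibbonGraph.val_pos Γ (G.opp h)).ne'
      have hy : G.next (G.next^[m] (G.opp h)) = G.opp h := by
        have := CutRibbonGraph.iterate_val Γ (G.opp h)
        rw [hm, Function.iterate_succ_apply'] at this
        exact this
      have hc : CarriesArrow (G.next^[m] (G.opp h)) :=
        Arrow.iterate_next_val ⟨G.opp h, carriesArrow_opp hh⟩ m ▸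
          (Arrow.next^[m] ⟨G.opp h, carriesArrow_opp hh⟩).2
      have he : CutRibbonGraph.edge Γ (CutRibbonGraph.next Γ h) =
          edge (G.next (G.next^[m] (G.opp h))) := by
        rw [hn, hy]; exact (CutRibbonGraph.edge_opp Γ h).symm
      rw [hm, Nat.succ_eq_add_one, CutRibbonGraph.word_succ', mul_assoc, he]
      exact congrArg _ (mul_idemElt_of_carriesArrow k hc)
  zero h := by
    change halfEdgeElt k h * halfEdgeElt k (G.opp (G.next h)) = 0
    by_cases hh : CarriesArrow h
    · by_cases ho : CarriesArrow (G.opp (G.next h))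
      · exact mul_eq_zero_of_carriesArrow k hh ho
      · rw [halfEdgeElt_of_not_carriesArrow k (hd := hd) (hd' := hd') ho, G.opp_opp]
        have hv : CutRibbonGraph.val Γ (G.next h) = CutRibbonGraph.val Γ h :=
          CutRibbonGraph.val_next Γ h
        -- An arrow followed by the cycle at its end is also the cycle at its start followed by the
        -- arrow: both are the word of length `val + 1`.
        have hw := CutRibbonGraph.word_succ Γ (halfEdgeElt k) h (CutRibbonGraph.val Γ h)
        rw [CutRibbonGraph.word_succ', CutRibbonGraph.iterate_val,
          cycle_mul_eq_zero k hG hh] at hw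
        rw [hv]
        exact hw.symm
    · have ho := carriesArrow_opp hh
      rw [next_eq_of_not_carriesArrow hh,
        halfEdgeElt_of_not_carriesArrow k (hd := hd) (hd' := hd') hh]
      exact cycle_mul_eq_zero k hG ho
  cycle h := by
    change _ = CutRibbonGraph.word Γ (halfEdgeElt k) (G.opp h) (CutRibbonGraph.val Γ (G.opp h))
    by_cases hh : CarriesArrow h
    · by_cases ho : CarriesArrow (G.opp h)
      · exact cycle_eq_of_carriesArrow k hG hh ho
      · rw [val_of_not_carriesArrow ho, CutRibbonGraph.word_one,
          halfEdgeElt_of_not_carriesArrow k (hd := hd) (hd' := hd') ho, G.opp_opp]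
    · rw [val_of_not_carriesArrow hh, CutRibbonGraph.word_one,
        halfEdgeElt_of_not_carriesArrow k (hd := hd) (hd' := hd') hh]

omit hG in
theorem adjoin_eq_top :
    Algebra.adjoin k (Set.range (idemElt (G := G) k) ∪ Set.range (halfEdgeElt k)) = ⊤ := by
  refine BoundQuiverAlgebra.subalgebra_eq_top _ (fun i => ?_) fun {i j} f => ?_
  · exact Algebra.subset_adjoin (Or.inl ⟨i, rfl⟩)
  · obtain ⟨a, rfl, rfl⟩ := f
    exact Algebra.subset_adjoin (Or.inr ⟨a.1, halfEdgeElt_of_carriesArrow k a⟩)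

/-- The converse direction: the defining relations of the Brauer graph algebra hold in every Brauer
system. -/
theorem exists_algHom {R : Type w} [Ring R] [Algebra k R] {e : G.Edge → R} {a : G.HalfEdge → R}
    (hs : CutRibbonGraph.IsBrauerSystem Γ e a) :
    ∃ f : G.algebra k →ₐ[k] R, (∀ i, f (idemElt k i) = e i) ∧ ∀ h, f (halfEdgeElt k h) = a h := by
  have hl : ∀ {i j : G.Edge} (f : i ⟶ j), e i * a f.1.1 = a f.1.1 := by
    rintro i j ⟨b, rfl, rfl⟩
    exact hs.source b.1
  have hr : ∀ {i j : G.Edge} (f : i ⟶ j), a f.1.1 * e j = a f.1.1 := by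
    rintro i j ⟨b, rfl, rfl⟩
    exact hs.target b.1
  set F : PathAlgebra k G.Edge →ₐ[k] R :=
    PathAlgebra.liftAlgHom k (arr := fun {i j : G.Edge} (f : i ⟶ j) => a f.1.1) hs.idem hr with hF
  have hFa : ∀ b : G.Arrow, F (arrowElt k b) = a b.1 := fun b =>
    PathAlgebra.liftAlgHom_ofArrow hs.idem hl hr _
  have hFc : ∀ b : G.Arrow, F (cycle k b) =
      CutRibbonGraph.word Γ a b.1 (CutRibbonGraph.val Γ b.1) :=
    map_cycle_eq_word k R F Γ rfl a hFa
  have hrel : ∀ x ∈ {x | Relation G k x}, F x = 0 := by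
    rintro x (⟨b, c, hbc⟩ | ⟨b, hb⟩ | ⟨b, c, hbc⟩)
    · simp only [hG, pow_one, map_sub, hFc]
      rw [hbc, sub_eq_zero]
      exact hs.cycle b.1
    · simp only [hG, pow_one, map_mul, hFc, hFa]
      -- The cycle equals the single arrow at the leaf, and this arrow followed by that of `b` is a
      -- non-consecutive product.
      have h1 := hs.cycle b.1
      have h2 : CutRibbonGraph.opp Γ b.1 = G.opp b.1 := rfl
      rw [h2, val_of_not_carriesArrow hb, CutRibbonGraph.word_one] at h1
      have h3 := hs.zero (G.opp b.1)
      have h4 : CutRibbonGraph.opp Γ (CutRibbonGraph.next Γ (G.opp b.1)) = b.1 := by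
        change G.opp (G.next (G.opp b.1)) = b.1
        rw [next_eq_of_not_carriesArrow hb, G.opp_opp]
      rw [h1]
      rwa [h4] at h3
    · rw [map_mul, hFa, hFa, hbc]
      exact hs.zero b.1
  obtain ⟨f, hf⟩ := BoundQuiverAlgebra.exists_lift F hrel
  refine ⟨f, fun i => (hf _).trans (PathAlgebra.liftAlgHom_nil hs.idem hr i), fun h => ?_⟩
  by_cases hh : CarriesArrow h
  · rw [halfEdgeElt_of_carriesArrow k ⟨h, hh⟩, hf, hFa]
  · rw [halfEdgeElt, dif_neg hh, hf, hFc]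
    have h1 := hs.cycle h
    rw [val_of_not_carriesArrow hh, CutRibbonGraph.word_one] at h1
    exact h1.symm

end BrauerGraph

open Classical in
theorem cyclicDerivative_triple (k : Type u) {V : Type v} [Field k] [Quiver.{v} V] [Fintype V]
    (e x y z : Σ a b : V, a ⟶ b) :
    cyclicDerivative k e [x, y, z] =
      (if x = e then PathAlgebra.ofArrow k y.2.2 * PathAlgebra.ofArrow k z.2.2 else 0) +
      (if y = e then PathAlgebra.ofArrow k z.2.2 * PathAlgebra.ofArrow k x.2.2 else 0) +
      (if z = e then PathAlgebra.ofArrow k x.2.2 * PathAlgebra.ofArrow k y.2.2 else 0) := by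
  rw [cyclicDerivative]
  change (∑ i : Fin 3, _) = _
  rw [Fin.sum_univ_three]
  simp [wordProd, List.rotate]

/-! ### Marked points on the boundary: turning always reaches a free side -/

namespace TriangleGluing

variable {X : TriangleGluing}

section Corners

variable (X) in
/-- Turning clockwise around the end point of a side, across its triangle and the next side of this
triangle if that side is glued. -/
def around : Equiv.Perm X.Side :=
  (⟨rot, rotInv, rotInv_rot, rot_rotInv⟩ : Equiv.Perm X.Side).trans X.glue

theorem around_apply (s : X.Side) : X.around s = X.glue (rot s) := rfl

/-- No free side is met by turning around the end point of `s`. -/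
def IsInterior (s : X.Side) : Prop := ∀ s', X.around.SameCycle s s' → X.glue s' ≠ s'

theorem isInterior_around_iff (s : X.Side) : IsInterior (X.around s) ↔ IsInterior s := by
  simp only [IsInterior, Equiv.Perm.sameCycle_apply_left]

theorem IsInterior.glue_ne {s : X.Side} (hs : IsInterior s) : X.glue s ≠ s :=
  hs s (Equiv.Perm.SameCycle.refl _ _)

theorem IsInterior.glue_rot_ne {s : X.Side} (hs : IsInterior s) : X.glue (rot s) ≠ rot s := by
  intro h
  have := ((isInterior_around_iff s).2 hs).glue_ne
  rw [around_apply, h] at this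
  exact this h

/-- The point `p` is a corner around which no free side is met. -/
def IsInteriorCorner (p : X.Point) : Prop := ∃ j, p.2.1 j = 1 ∧ IsInterior ((p.1, j + 2) : X.Side)

theorem fin_three_cases (i j : Fin 3) : j = i ∨ j = i + 1 ∨ j = i + 2 := by
  revert i j
  decide

theorem fin_three_add (i : Fin 3) : i + 1 + 2 = i := by
  revert i
  decide

theorem Glued.symm {p q : X.Point} (h : Glued p q) : Glued q p := by
  obtain ⟨s, hs, hp, hq, h1, h2⟩ := h
  exact ⟨X.glue s, by rw [X.glue_glue]; exact hs.symm, hq, by rwa [X.glue_glue],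
    by rw [X.glue_glue]; exact h2.symm, by rw [X.glue_glue]; exact h1.symm⟩

/-- Gluing along `s` matches its start with the end of `glue s` and conversely; the sides ending at
matched corners differ by one application of `around`, so they have the same orbit. -/
theorem Glued.isInteriorCorner {p q : X.Point} (h : Glued p q) (hp : IsInteriorCorner p) :
    IsInteriorCorner q := by
  obtain ⟨s, -, ⟨hp1, hp2⟩, ⟨hq1, -⟩, h1, h2⟩ := h
  obtain ⟨j, hj, hint⟩ := hp
  rcases fin_three_cases s.2 j with rfl | rfl | rfl
  · refine ⟨(X.glue s).2 + 1, h1 ▸ hj, ?_⟩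
    have e1 : ((q.1, (X.glue s).2 + 1 + 2) : X.Side) = X.around (p.1, s.2 + 2) := by
      have : ((p.1, s.2 + 2) : X.Side) = rotInv s := Prod.ext hp1 rfl
      rw [this, around_apply, rot_rotInv, fin_three_add, hq1]
    rw [e1, isInterior_around_iff]
    exact hint
  · refine ⟨(X.glue s).2, h2 ▸ hj, ?_⟩
    have e1 : X.around (q.1, (X.glue s).2 + 2) = (p.1, s.2 + 1 + 2) := by
      have : ((q.1, (X.glue s).2 + 2) : X.Side) = rotInv (X.glue s) := Prod.ext hq1 rfl
      rw [this, around_apply, rot_rotInv, X.glue_glue, fin_three_add, hp1]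
    rw [← isInterior_around_iff, e1]
    exact hint
  · rw [hp2] at hj
    exact absurd hj zero_ne_one

theorem isInteriorCorner_iff_of_eqvGen {p q : X.Point} (h : Relation.EqvGen Glued p q) :
    IsInteriorCorner p ↔ IsInteriorCorner q := by
  induction h with
  | rel p q h => exact ⟨h.isInteriorCorner, h.symm.isInteriorCorner⟩
  | refl => exact Iff.rfl
  | symm p q _ ih => exact ih.symm
  | trans p q r _ _ ih1 ih2 => exact ih1.trans ih2

theorem IsInteriorCorner.not_onSide {p : X.Point} (hp : IsInteriorCorner p) {s : X.Side}
    (hs : X.glue s = s) : ¬ OnSide p s := by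
  rintro ⟨h1, h2⟩
  obtain ⟨j, hj, hint⟩ := hp
  rcases fin_three_cases s.2 j with rfl | rfl | rfl
  · have : ((p.1, s.2 + 2) : X.Side) = rotInv s := Prod.ext h1 rfl
    rw [this] at hint
    have := hint.glue_rot_ne
    rw [rot_rotInv] at this
    exact this hs
  · have : ((p.1, s.2 + 1 + 2) : X.Side) = s := Prod.ext h1 (fin_three_add _)
    rw [this] at hint
    exact hint.glue_ne hs
  · rw [h2] at hj
    exact zero_ne_one hj

/-- The corner where `s` ends represents a marked point, hence is identified with a point of a free
side. Having only inner sides around it is invariant under identification, but impossible on a free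
side. -/
theorem _root_.IdealTriangulation.not_isInterior {S : Type v} [TopologicalSpace S] {M : Set S}
    (T : IdealTriangulation S M) (hM : M ⊆ T.boundary) (s : T.Side) : ¬ IsInterior s := by
  intro hs
  let p : T.Point := (s.1, ⟨Pi.single (s.2 + 1) 1, single_mem_stdSimplex ℝ _⟩)
  have h1 : p.2.1 (s.2 + 1) = 1 := Pi.single_eq_same _ _
  have hp : IsInteriorCorner p := ⟨s.2 + 1, h1, by rw [fin_three_add]; exact hs⟩
  have hpM : T.chart p ∈ M := T.image_corners.subset ⟨p, ⟨_, h1⟩, rfl⟩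
  obtain ⟨q, ⟨s', hs', hq⟩, hqp⟩ := hM hpM
  have := (isInteriorCorner_iff_of_eqvGen ((T.chart_eq_iff q p).1 hqp)).2 hp
  exact this.not_onSide hs' hq

/-- While no free side is met, `turn` agrees with the permutation `around`. Were none ever met, the
forward iterates would exhaust the finite orbit and make it interior. -/
theorem exists_free_of_not_isInterior {h : X.InnerSide} (hh : ¬ IsInterior h.1) :
    ∃ n, X.glue (rot (turn^[n] h).1) = rot (turn^[n] h).1 := by
  by_contra hcon
  push Not at hcon
  refine hh fun s' hs' => ?_
  obtain ⟨n, rfl⟩ := hs'.exists_nat_pow_eq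
  have key : ∀ n : ℕ, (X.around ^ n) h.1 = (turn^[n] h).1 := by
    intro n
    induction n with
    | zero => rfl
    | succ n ih =>
      rw [pow_succ', Equiv.Perm.mul_apply, ih, Function.iterate_succ_apply', turn,
        dif_pos (hcon n)]
      rfl
  rw [key]
  exact (turn^[n] h).2

end Corners

/-! ### The cut given by the distance to the boundary -/

section Distance

variable (hX : ∀ h : X.InnerSide, ∃ n, X.glue (rot (turn^[n] h).1) = rot (turn^[n] h).1)

open Classical in
/-- The number of clockwise turns from an arc end to the boundary. -/
def boundaryDist (h : X.InnerSide) : ℕ := Nat.find (hX h)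

theorem boundaryDist_eq_zero_iff (h : X.InnerSide) :
    boundaryDist hX h = 0 ↔ X.glue (rot h.1) = rot h.1 := by
  classical
  exact Nat.find_eq_zero (hX h)

theorem boundaryDist_turn {h : X.InnerSide} (hh : X.glue (rot h.1) ≠ rot h.1) :
    boundaryDist hX (turn h) + 1 = boundaryDist hX h := by
  classical
  exact (Nat.find_comp_succ (hX h) (hX (turn h)) hh).symm

theorem next_of_ne {h : X.InnerSide} (hh : X.glue (rot h.1) ≠ rot h.1) : next h = turn h :=
  if_pos hh

theorem opp_next_of_ne {h : X.InnerSide} (hh : X.glue (rot h.1) ≠ rot h.1) :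
    opp (next h) = ⟨rot h.1, hh⟩ := by
  rw [next_of_ne hh, turn, dif_pos hh, opp_opp]

theorem boundaryDist_next (h : X.InnerSide) (h0 : boundaryDist hX h ≠ 0) :
    boundaryDist hX (next h) + 1 = boundaryDist hX h := by
  have hh := (boundaryDist_eq_zero_iff hX h).not.1 h0
  rw [next_of_ne hh, boundaryDist_turn hX hh]

/-- The last arc end before the boundary is an invariant of turning back. This identifies where the
walk started by the wrap-around of `nextFun` ends. -/
theorem iterate_next_turnBack (h : X.InnerSide) :
    next^[boundaryDist hX (turnBack h)] (turnBack h) = next^[boundaryDist hX h] h := by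
  by_cases hs : X.glue (rotInv (opp h).1) ≠ rotInv (opp h).1
  · have h1 : turnBack h = ⟨rotInv (opp h).1, hs⟩ := dif_pos hs
    have h2 : rot (turnBack h).1 = (opp h).1 := by rw [h1]; exact rot_rotInv _
    have h3 : X.glue (rot (turnBack h).1) ≠ rot (turnBack h).1 := by
      rw [h2]; exact (opp h).2
    have h4 : turn (turnBack h) = h := by
      rw [turn, dif_pos h3]
      exact Subtype.ext ((congrArg X.glue h2).trans (X.glue_glue h.1))
    have h5 := boundaryDist_turn hX h3
    rw [h4] at h5
    rw [← h5, Function.iterate_succ_apply, next_of_ne h3, h4]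
  · rw [turnBack, dif_neg hs]

theorem iterate_boundaryDist_next (h : X.InnerSide) (h0 : boundaryDist hX h = 0) :
    next^[boundaryDist hX (next h)] (next h) = h := by
  have hh := (boundaryDist_eq_zero_iff hX h).1 h0
  have key : ∀ n, next^[boundaryDist hX (turnBack^[n] h)] (turnBack^[n] h) = h := by
    intro n
    induction n with
    | zero => rw [Function.iterate_zero_apply, h0]; rfl
    | succ n ih => rw [Function.iterate_succ_apply', iterate_next_turnBack, ih]
  have hn : next h = turnBack^[Fintype.card X.InnerSide] h := if_neg (not_not.2 hh)
  rw [hn, key]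

/-- The Brauer graph of the triangulation, cut along the boundary. -/
def cutGraph : CutRibbonGraph X.InnerSide X.Arc :=
  X.brauerGraph.cutRibbonGraph (boundaryDist hX) (boundaryDist_next hX)
    (iterate_boundaryDist_next hX)

end Distance

/-! ### The Jacobian algebra as the universal gentle system -/

section Jacobian

variable (k : Type u) [Field k]

/-- The trivial path at an arc, as an element of the Jacobian algebra. -/
def jacobianIdem (i : X.Arc) : X.jacobianAlgebra k :=
  BoundQuiverAlgebra.proj _ (PathAlgebra.ofPath k (Quiver.Path.nil : Quiver.Path i i))

/-- The arrow of an angle. -/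
def angleArrow (h : X.InnerSide) (hh : X.glue (rot h.1) ≠ rot h.1) :
    arc h ⟶ arc (⟨rot h.1, hh⟩ : X.InnerSide) :=
  ⟨⟨h.1, h.2, hh⟩, rfl, rfl⟩

open Classical in
/-- The arrow of the angle that starts at an inner side, as an element of the Jacobian algebra; zero
if the angle lies at the boundary. -/
def jacobianArrow (h : X.InnerSide) : X.jacobianAlgebra k :=
  if hh : X.glue (rot h.1) ≠ rot h.1 then
    BoundQuiverAlgebra.proj _ (PathAlgebra.ofArrow k (angleArrow h hh)) else 0

theorem jacobianArrow_of_ne {h : X.InnerSide} (hh : X.glue (rot h.1) ≠ rot h.1) :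
    jacobianArrow k h = BoundQuiverAlgebra.proj _ (PathAlgebra.ofArrow k (angleArrow h hh)) :=
  dif_pos hh

theorem InternalTriangle.arrow_inj {t t' : X.InternalTriangle} {i j : Fin 3}
    (h : t.arrow i = t'.arrow j) : t = t' ∧ i = j := by
  have h1 : ((t.1, i) : X.Side) = (t'.1, j) :=
    congrArg (fun f : Σ a b : X.Arc, a ⟶ b => f.2.2.1.1) h
  exact ⟨Subtype.ext (congrArg Prod.fst h1), congrArg Prod.snd h1⟩

/-- An arrow determines its triangle and its position there, so only one term of the potential
contributes. -/
theorem sum_cyclicDerivative_potential (t : X.InternalTriangle) (i : Fin 3) :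
    ∑ t', cyclicDerivative k (t.arrow (i + 2)) (X.potential t') =
      PathAlgebra.ofArrow k (t.arrow i).2.2 * PathAlgebra.ofArrow k (t.arrow (i + 1)).2.2 := by
  classical
  have hinj : ∀ i j, t.arrow i = t.arrow j ↔ i = j :=
    fun i j => ⟨fun h => (InternalTriangle.arrow_inj h).2, fun h => h ▸ rfl⟩
  rw [Finset.sum_eq_single t]
  · rw [potential, cyclicDerivative_triple]
    simp only [hinj]
    fin_cases i <;> simp
  · intro t' _ hne
    rw [potential, cyclicDerivative_triple, if_neg, if_neg, if_neg, add_zero, add_zero] <;>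
      exact fun h => hne (InternalTriangle.arrow_inj h).1
  · exact fun h => absurd (Finset.mem_univ t) h

variable (hX : ∀ h : X.InnerSide, ∃ n, X.glue (rot (turn^[n] h).1) = rot (turn^[n] h).1)

/-- In an internal triangle the product is a cyclic derivative; otherwise the third side is free and
the second factor is zero by convention. -/
theorem jacobianArrow_mul_eq_zero {h : X.InnerSide} (hh : X.glue (rot h.1) ≠ rot h.1) :
    jacobianArrow k h * jacobianArrow k ⟨rot h.1, hh⟩ = 0 := by
  by_cases hh' : X.glue (rot (rot h.1)) ≠ rot (rot h.1)
  · obtain ⟨⟨t, i⟩, hi⟩ := h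
    let t' : X.InternalTriangle := ⟨t, fun j => by
      rcases fin_three_cases i j with rfl | rfl | rfl
      · exact hi
      · exact hh
      · have : ((t, i + 2) : X.Side) = rot (rot (t, i)) :=
          Prod.ext rfl (add_assoc i 1 1).symm
        rw [this]; exact hh'⟩
    rw [jacobianArrow_of_ne k hh, jacobianArrow_of_ne k (h := ⟨rot (t, i), hh⟩) hh', ← map_mul]
    exact BoundQuiverAlgebra.proj_eq_zero
      ⟨t'.arrow (i + 2), sum_cyclicDerivative_potential k t' i⟩
  · rw [jacobianArrow, jacobianArrow, dif_neg (c := X.glue (rot (rot h.1)) ≠ _) hh', mul_zero]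

theorem isGentleSystem_jacobian :
    (cutGraph hX).IsGentleSystem (jacobianIdem k) (jacobianArrow k) where
  idem := (PathAlgebra.completeOrthogonalIdempotents_nil k X.Arc).map
    (BoundQuiverAlgebra.proj _).toRingHom
  source h := by
    by_cases hh : X.glue (rot h.1) ≠ rot h.1
    · rw [jacobianArrow_of_ne k hh, jacobianIdem, ← map_mul]
      exact congrArg _ (PathAlgebra.nil_mul_ofArrow _)
    · rw [jacobianArrow, dif_neg hh, mul_zero]
  target h := by
    by_cases hh : X.glue (rot h.1) ≠ rot h.1
    · have he : (cutGraph hX).edge ((cutGraph hX).next h) = arc ⟨rot h.1, hh⟩ := by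
        rw [← (cutGraph hX).edge_opp]
        exact congrArg arc (opp_next_of_ne hh)
      rw [he, jacobianArrow_of_ne k hh, jacobianIdem, ← map_mul]
      exact congrArg _ (PathAlgebra.ofArrow_mul_nil _)
    · rw [jacobianArrow, dif_neg hh, zero_mul]
  zero h := by
    by_cases hh : X.glue (rot h.1) ≠ rot h.1
    · have he : (cutGraph hX).opp ((cutGraph hX).next h) = ⟨rot h.1, hh⟩ := opp_next_of_ne hh
      rw [he, jacobianArrow_mul_eq_zero]
    · rw [jacobianArrow, dif_neg hh, zero_mul]
  cut h h0 := dif_neg (not_not.2 ((boundaryDist_eq_zero_iff hX h).1 h0))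

theorem adjoin_jacobian_eq_top :
    Algebra.adjoin k (Set.range (jacobianIdem (X := X) k) ∪ Set.range (jacobianArrow k)) = ⊤ := by
  refine BoundQuiverAlgebra.subalgebra_eq_top _ (fun i => ?_) fun {i j} f => ?_
  · exact Algebra.subset_adjoin (Or.inl ⟨i, rfl⟩)
  · obtain ⟨a, rfl, rfl⟩ := f
    exact Algebra.subset_adjoin (Or.inr ⟨⟨a.1, a.2.1⟩, jacobianArrow_of_ne k a.2.2⟩)

/-- Successive arrows of an internal triangle are non-consecutive around marked points, so every
term of a cyclic derivative vanishes in a gentle system. -/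
theorem exists_algHom_jacobian {R : Type w} [Ring R] [Algebra k R] {e : X.Arc → R}
    {a : X.InnerSide → R} (hs : (cutGraph hX).IsGentleSystem e a) :
    ∃ f : X.jacobianAlgebra k →ₐ[k] R,
      (∀ i, f (jacobianIdem k i) = e i) ∧ ∀ h, f (jacobianArrow k h) = a h := by
  have hl : ∀ {i j : X.Arc} (f : i ⟶ j), e i * a ⟨f.1.1, f.1.2.1⟩ = a ⟨f.1.1, f.1.2.1⟩ := by
    rintro i j ⟨b, rfl, rfl⟩
    exact hs.source ⟨b.1, b.2.1⟩
  have hr : ∀ {i j : X.Arc} (f : i ⟶ j), a ⟨f.1.1, f.1.2.1⟩ * e j = a ⟨f.1.1, f.1.2.1⟩ := by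
    rintro i j ⟨b, rfl, rfl⟩
    have he : (cutGraph hX).edge ((cutGraph hX).next ⟨b.1, b.2.1⟩) = arc ⟨rot b.1, b.2.2⟩ := by
      rw [← (cutGraph hX).edge_opp]
      exact congrArg arc (opp_next_of_ne (h := ⟨b.1, b.2.1⟩) b.2.2)
    have := hs.target ⟨b.1, b.2.1⟩
    rwa [he] at this
  set F : PathAlgebra k X.Arc →ₐ[k] R := PathAlgebra.liftAlgHom k
    (arr := fun {i j : X.Arc} (f : i ⟶ j) => a ⟨f.1.1, f.1.2.1⟩) hs.idem hr with hF
  have hFa : ∀ {i j : X.Arc} (f : i ⟶ j), F (PathAlgebra.ofArrow k f) = a ⟨f.1.1, f.1.2.1⟩ :=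
    fun f => PathAlgebra.liftAlgHom_ofArrow hs.idem hl hr f
  have hFt : ∀ (t : X.InternalTriangle) (i : Fin 3),
      F (PathAlgebra.ofArrow k (t.arrow i).2.2) *
        F (PathAlgebra.ofArrow k (t.arrow (i + 1)).2.2) = 0 := by
    intro t i
    rw [hFa, hFa]
    have h1 : (cutGraph hX).opp ((cutGraph hX).next ⟨(t.1, i), t.2 i⟩) =
        ⟨(t.1, i + 1), t.2 (i + 1)⟩ :=
      opp_next_of_ne (h := ⟨(t.1, i), t.2 i⟩) (t.2 (i + 1))
    have h2 := hs.zero ⟨(t.1, i), t.2 i⟩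
    rwa [h1] at h2
  obtain ⟨f, hf⟩ := BoundQuiverAlgebra.exists_lift (ρ := Set.range
      fun e : (Σ a b : X.Arc, a ⟶ b) => ∑ t, cyclicDerivative k e (X.potential t)) F (by
    classical
    rintro _ ⟨e, rfl⟩
    simp only [map_sum]
    refine Finset.sum_eq_zero fun t _ => ?_
    rw [potential, cyclicDerivative_triple]
    simp only [map_add, apply_ite F, map_mul, map_zero]
    have h0 : F (PathAlgebra.ofArrow k (t.arrow 0).2.2) *
      F (PathAlgebra.ofArrow k (t.arrow 1).2.2) = 0 := hFt t 0
    have h1 : F (PathAlgebra.ofArrow k (t.arrow 1).2.2) *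
      F (PathAlgebra.ofArrow k (t.arrow 2).2.2) = 0 := hFt t 1
    have h2 : F (PathAlgebra.ofArrow k (t.arrow 2).2.2) *
      F (PathAlgebra.ofArrow k (t.arrow 0).2.2) = 0 := hFt t 2
    simp [h0, h1, h2])
  refine ⟨f, fun i => (hf _).trans (PathAlgebra.liftAlgHom_nil hs.idem hr i), fun h => ?_⟩
  by_cases hh : X.glue (rot h.1) ≠ rot h.1
  · rw [jacobianArrow_of_ne k hh]
    exact (hf _).trans (hFa _)
  · rw [jacobianArrow, dif_neg hh, map_zero]
    exact (hs.cut h ((boundaryDist_eq_zero_iff hX h).2 (not_not.1 hh))).symm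

include hX in
/-- If every marked point lies on the boundary, the trivial extension of the Jacobian algebra is the
Brauer graph algebra. -/
theorem nonempty_algEquiv_brauerGraph :
    Nonempty (TrivialExtension k (X.jacobianAlgebra k) ≃ₐ[k] X.brauerGraph.algebra k) :=
  CutRibbonGraph.nonempty_algEquiv (isGentleSystem_jacobian k hX) (adjoin_jacobian_eq_top k)
    (exists_algHom_jacobian k hX ((cutGraph hX).isGentleSystem_act k))
    (BrauerGraph.isBrauerSystem k fun _ => rfl) (BrauerGraph.adjoin_eq_top k)
    fun _ _ hs => BrauerGraph.exists_algHom k (fun _ => rfl) hs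

end Jacobian

end TriangleGluing
end

theorem corollary1p5 {k : Type*} [Field k] [IsAlgClosed k] {S : Type*} [TopologicalSpace S]
    [ConnectedSpace S] (M : Set S) (T : IdealTriangulation S M) (hM : M ⊆ T.boundary)
    (hT : Nonempty T.Arc) :
    Nonempty (TrivialExtension k (T.jacobianAlgebra k) ≃ₐ[k] T.brauerGraph.algebra k) := by
  exact TriangleGluing.nonempty_algEquiv_brauerGraph k fun h =>
    TriangleGluing.exists_free_of_not_isInterior (T.not_isInterior hM h.1)
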